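/- A weight function is a non-decreasing, continuous and unbounded function $w:[0,+\infty)\to(0,+\infty)$; for $q\ge 2$ it induces the radial weight $w(y)=w(|y|)$ on $\mathbb R^q$, where $|\cdot|$ is the Euclidean norm. Two functions $u,v:X\to[0,+\infty)$ are called equivalent, written $u\asymp v$, if there are constants $C_1,C_2>0$ such that $C_1u(x)\le v(x)\le C_2u(x)$ for all $x\in X$. A function $\Psi:\mathbb R\to\mathbb R$ is a tropical power series if there are a set $E\subseteq\{0,1,2,\dots\}$ and real numbers $b_j$, $j\in E$, such that $\Psi(x)=\sup_{j\in E}(b_j+jx)$ for all $x\in\mathbb R$, the supremum being finite for every $x$. A weight function $v$ is log-tropical if $x\mapsto\log v(e^x)$, $x\in\mathbb R$, is a tropical power series. The radial weight $w$ on $\mathbb R^q$ is approximable by a harmonic map if there are an integer $m\ge 1$ and a harmonic map $h:\mathbb R^q\to\mathbb R^m$ such that $|h(y)|\asymp w(|y|)$, $y\in\mathbb R^q$. **Proposition.** Let $q\ge 2$ and let $w$ be a weight function, regarded also as a radial weight on $\mathbb R^q$. (i) If the radial weight $w$ on $\mathbb R^q$ is approximable by a harmonic map, then the weight function $w$ is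 equivalent on $[0,+\infty)$ to a log-tropical weight function. (ii) If $q$ is even, then the radial weight $w$ on $\mathbb R^q$ is approximable by a harmonic map if and only if the weight function $w$ is equivalent on $[0,+\infty)$ to a log-tropical weight function. -/

import Mathlib

open scoped NNReal

/-- A weight function `w : [0, +∞) → (0, +∞)`: positive, non-decreasing, continuous and
unbounded. The half-line `[0, +∞)` is the type `ℝ≥0`. -/
structure IsWeightFunction (w : ℝ≥0 → ℝ) : Prop where
  pos : ∀ t, 0 < w t
  monotone : Monotone w
  continuous : Continuous w
  unbounded : ¬ BddAbove (Set.range w)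

/-- `u ≍ v`: the functions `u` and `v` on `X` are equivalent, that is, comparable up to
positive multiplicative constants. -/
def WeightEquiv {X : Type*} (u v : X → ℝ) : Prop :=
  ∃ C₁ C₂ : ℝ, 0 < C₁ ∧ 0 < C₂ ∧ ∀ x, C₁ * u x ≤ v x ∧ v x ≤ C₂ * u x

/-- The radial weight on `ℝ^q` given by a weight function: `y ↦ w |y|`, with the Euclidean norm. -/
noncomputable def radialWeight (q : ℕ) (w : ℝ≥0 → ℝ) (y : EuclideanSpace ℝ (Fin q)) : ℝ :=
  w ‖y‖₊

/-- `Ψ : ℝ → ℝ` is a tropical power series: `Ψ x = sup_{j ∈ E} (b j + j x)` for some set `E` of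
non-negative integers and some real coefficients, the supremum being finite for every `x`
(`IsLUB` in `ℝ`; in particular `E` is not empty). -/
def IsTropicalPowerSeries (Ψ : ℝ → ℝ) : Prop :=
  ∃ (E : Set ℕ) (b : ℕ → ℝ), ∀ x : ℝ, IsLUB ((fun j : ℕ => b j + (j : ℝ) * x) '' E) (Ψ x)

/-- The logarithmic transform `x ↦ log (v (e ^ x))` of a function on `[0, +∞)`. -/
noncomputable def logTransform (v : ℝ≥0 → ℝ) (x : ℝ) : ℝ :=
  Real.log (v (Real.exp x).toNNReal)

/-- A log-tropical weight function. -/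
def IsLogTropicalWeight (v : ℝ≥0 → ℝ) : Prop :=
  IsWeightFunction v ∧ IsTropicalPowerSeries (logTransform v)

/-- `w` is equivalent on `[0, +∞)` to a log-tropical weight function. -/
def EquivLogTropical (w : ℝ≥0 → ℝ) : Prop :=
  ∃ v : ℝ≥0 → ℝ, IsLogTropicalWeight v ∧ WeightEquiv v w

/-- The radial weight on `ℝ^q` given by `w` is approximable by a harmonic map: `|h| ≍ w` on `ℝ^q`
for some `m ≥ 1` and some harmonic map `h : ℝ^q → ℝ^m`. -/
def HarmonicApproximable (q : ℕ) (w : ℝ≥0 → ℝ) : Prop :=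
  ∃ (m : ℕ) (h : EuclideanSpace ℝ (Fin q) → EuclideanSpace ℝ (Fin m)),
    1 ≤ m ∧ InnerProductSpace.HarmonicOnNhd h Set.univ ∧
      WeightEquiv (fun y => ‖h y‖) (radialWeight q w)

/-!
**From harmonic maps to tropical series.** Averaging `|h|²` over the orthogonal group (`rotAvg`)
gives a function `M(r)` of the radius with `M ≍ w²`. The iterated Laplacians of `|h|²` are sums of
squares of harmonic functions (`IsHarmonicSumSq.laplacian`), hence non-negative, and the radial
Laplace equation expresses each averaged Laplacian through the next one
(`rotAvg_eq_add_scaleAvg`). This is Pizzetti's expansion, and, as in Bernstein's theorem on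
absolutely monotone functions, positivity forces it to converge: the `n`-th remainder divided by
`r²ⁿ` is non-decreasing (`pizzetti_remainder`). So `M(r) = ∑ aₖ r²ᵏ` with `aₖ ≥ 0`. The terms of
such a series at a given radius are the weights of a distribution on `ℕ`; if `j` is its median, then
`M(r) r⁻²ʲ ≤ 2 M(s) s⁻²ʲ` for every `s` (`exists_median_power`). Hence `log √M`, in the variable
`log r`, lies within `log 2 / 2` of its largest tropical minorant, the exponential of which is the
required weight. The expansion needs `h` to be smooth; this follows from the mean value property,
which exhibits `h` as its own convolution with a radial bump (`contDiff_of_harmonic`).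

**From tropical series to harmonic maps, `q = 2 p`.** It suffices to find a holomorphic map `F` on
`ℂᵖ` with `|F(z)| ≍ v(|z|)` for a log-tropical `v`. A tropical series can be thinned out to a chain
of lines whose sup is still within a constant of it, and such that at each point the lines decay
linearly in their rank distance to a nearly maximal line (`exists_thinning`). Colouring the chain
by rank modulo a large `J` gives `J` power series; at each radius one term of one of them dominates
the sum of all the other terms of that series, and is comparable to `v` (`exists_lacunary_split`).
Substituting for the monomial `rʲ` a holomorphic map `Wⱼ` with `|Wⱼ(z)| ≍ |z|ʲ`, uniformly in `j`,
gives `F` (`exists_holomorphic_assembly`). The maps `Wⱼ` come from the same construction, by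
induction on the dimension: `(|z'|² + |ζ|²)^(d/2)` is, up to a factor independent of `d`, a
tropical polynomial in `log (|z'| / |ζ|)`, by the median argument applied to the binomial expansion
of `(1 + r²)ᵈ` (`exists_holomorphic_norm_pow`).
-/

open scoped ContDiff

/-! ### Tropical minorants and medians -/

/-- If each point admits a slope in `J` whose line through the graph of `φ` lies below `φ + c`, then
the sup of all lines below `φ` with slopes in `J` is a tropical power series within `c` of `φ`. The
last clause says that this sup is the largest such minorant. -/
theorem exists_tropical_minorant {φ : ℝ → ℝ} {J : Set ℕ} {c : ℝ}
    (h : ∀ x, ∃ j ∈ J, ∀ y, φ x - j * x ≤ φ y - j * y + c) :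
    ∃ (E : Set ℕ) (b : ℕ → ℝ) (Ψ : ℝ → ℝ), E ⊆ J ∧
      (∀ x : ℝ, IsLUB ((fun j : ℕ => b j + (j : ℝ) * x) '' E) (Ψ x)) ∧
      (∀ x, Ψ x ≤ φ x) ∧ (∀ x, φ x ≤ Ψ x + c) ∧
      ∀ j ∈ J, ∀ β : ℝ, (∀ y, β + j * y ≤ φ y) → ∀ x, β + j * x ≤ Ψ x := by
  set E : Set ℕ := {j | j ∈ J ∧ BddBelow (Set.range fun y : ℝ => φ y - j * y)} with hE
  set b : ℕ → ℝ := fun j => ⨅ y : ℝ, (φ y - j * y) with hb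
  have hle : ∀ j ∈ E, ∀ x, b j + j * x ≤ φ x := fun j hj x => by
    have : b j ≤ φ x - j * x := ciInf_le hj.2 x
    linarith
  have hge : ∀ j ∈ J, ∀ β : ℝ, (∀ y, β + j * y ≤ φ y) → j ∈ E ∧ β ≤ b j := by
    intro j hj β hβ
    have h' : ∀ y : ℝ, β ≤ φ y - j * y := fun y => by linarith [hβ y]
    exact ⟨⟨hj, β, by rintro _ ⟨y, rfl⟩; exact h' y⟩, le_ciInf h'⟩
  have hne : ∀ x, ∃ j ∈ E, φ x - c ≤ b j + j * x := by
    intro x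
    obtain ⟨j, hj, hy⟩ := h x
    obtain ⟨h1, h2⟩ := hge j hj (φ x - j * x - c) (fun y => by linarith [hy y])
    exact ⟨j, h1, by linarith⟩
  have hbdd : ∀ x : ℝ, BddAbove ((fun j : ℕ => b j + (j : ℝ) * x) '' E) := fun x =>
    ⟨φ x, by rintro _ ⟨j, hj, rfl⟩; exact hle j hj x⟩
  have hnon : ∀ x : ℝ, ((fun j : ℕ => b j + (j : ℝ) * x) '' E).Nonempty := fun x => by
    obtain ⟨j, hj, -⟩ := hne x
    exact ⟨_, j, hj, rfl⟩
  refine ⟨E, b, fun x => sSup ((fun j : ℕ => b j + (j : ℝ) * x) '' E), fun j hj => hj.1,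
    fun x => isLUB_csSup (hnon x) (hbdd x), fun x => csSup_le (hnon x) ?_, fun x => ?_, ?_⟩
  · rintro _ ⟨j, hj, rfl⟩
    exact hle j hj x
  · obtain ⟨j, hj, hjx⟩ := hne x
    have := le_csSup (hbdd x) ⟨j, hj, rfl⟩
    simp only at this
    linarith
  · intro j hj β hβ x
    obtain ⟨h1, h2⟩ := hge j hj β hβ
    have := le_csSup (hbdd x) ⟨j, h1, rfl⟩
    simp only at this
    linarith

/-- A median of the finite measure on `ℕ` with masses `a k`; it can be taken to be an atom. -/
theorem exists_median {a : ℕ → ℝ} (hs : Summable a) (hpos : 0 < ∑' k, a k) :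
    ∃ j, a j ≠ 0 ∧ (∑' k, a k) / 2 ≤ ∑ k ∈ Finset.range (j + 1), a k ∧
      (∑' k, a k) / 2 ≤ ∑' k, a (k + j) := by
  have hex : ∃ n, (∑' k, a k) / 2 ≤ ∑ k ∈ Finset.range (n + 1), a k := by
    have ht := (Filter.tendsto_add_atTop_iff_nat 1).2 hs.hasSum.tendsto_sum_nat
    exact (ht.eventually (le_mem_nhds (by linarith))).exists
  classical
  refine ⟨Nat.find hex, ?_, Nat.find_spec hex, ?_⟩
  all_goals
    have hlt : ∑ k ∈ Finset.range (Nat.find hex), a k < (∑' k, a k) / 2 := by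
      rcases Nat.eq_zero_or_pos (Nat.find hex) with h0 | h0
      · rw [h0]; simpa using by linarith
      · have := Nat.find_min hex (Nat.sub_lt h0 one_pos)
        rwa [Nat.sub_one_add_one h0.ne', not_le] at this
  · intro h0
    have := Nat.find_spec hex
    rw [Finset.sum_range_succ, h0] at this
    linarith
  · have := hs.sum_add_tsum_nat_add (Nat.find hex)
    linarith

/-- The median `j` of the weights `a k * r ^ (2 * k)` gives a nearly optimal slope at `r`: when
`r ≤ s` the terms of index at least `j` grow at least like `s ^ (2 * j)`, and when `s ≤ r` the terms
of index at most `j` decay at most that fast; either half carries half of the mass. -/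
theorem exists_median_power {a : ℕ → ℝ} {M : ℝ → ℝ} (ha : ∀ k, 0 ≤ a k)
    (hM : ∀ r, 0 < r → HasSum (fun k => a k * r ^ (2 * k)) (M r))
    (hpos : ∀ r, 0 < r → 0 < M r) {r : ℝ} (hr : 0 < r) :
    ∃ j, a j ≠ 0 ∧ ∀ s, 0 < s → M r * s ^ (2 * j) ≤ 2 * M s * r ^ (2 * j) := by
  have hnn : ∀ s : ℝ, ∀ k, 0 ≤ a k * s ^ (2 * k) := fun s k =>
    mul_nonneg (ha k) ((even_two_mul k).pow_nonneg s)
  obtain ⟨j, hj0, hj1, hj2⟩ := exists_median (hM r hr).summable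
    (by rw [(hM r hr).tsum_eq]; exact hpos r hr)
  rw [(hM r hr).tsum_eq] at hj1 hj2
  refine ⟨j, fun h => hj0 (by simp [h]), fun s hs => ?_⟩
  rcases le_total r s with hrs | hrs
  · have hsr : Summable fun k => a (k + j) * r ^ (2 * (k + j)) :=
      (summable_nat_add_iff (f := fun k => a k * r ^ (2 * k)) j).2 (hM r hr).summable
    have hss : Summable fun k => a (k + j) * s ^ (2 * (k + j)) :=
      (summable_nat_add_iff (f := fun k => a k * s ^ (2 * k)) j).2 (hM s hs).summable
    have h1 : ∑' k, a (k + j) * s ^ (2 * (k + j)) ≤ M s := by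
      rw [← (hM s hs).tsum_eq, ← (hM s hs).summable.sum_add_tsum_nat_add j]
      have := Finset.sum_nonneg fun k (_ : k ∈ Finset.range j) => hnn s k
      linarith
    have h2 : (∑' k, a (k + j) * r ^ (2 * (k + j))) * s ^ (2 * j) ≤
        (∑' k, a (k + j) * s ^ (2 * (k + j))) * r ^ (2 * j) := by
      rw [← tsum_mul_right, ← tsum_mul_right]
      refine (hsr.mul_right _).tsum_le_tsum (fun k => ?_) (hss.mul_right _)
      have : r ^ (2 * k) ≤ s ^ (2 * k) := pow_le_pow_left₀ hr.le hrs _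
      calc a (k + j) * r ^ (2 * (k + j)) * s ^ (2 * j)
          = (a (k + j) * (r ^ (2 * j) * s ^ (2 * j))) * r ^ (2 * k) := by ring
        _ ≤ (a (k + j) * (r ^ (2 * j) * s ^ (2 * j))) * s ^ (2 * k) :=
            mul_le_mul_of_nonneg_left this (mul_nonneg (ha _) (by positivity))
        _ = a (k + j) * s ^ (2 * (k + j)) * r ^ (2 * j) := by ring
    have h3 := mul_le_mul_of_nonneg_right hj2 (show 0 ≤ s ^ (2 * j) by positivity)
    have h4 := mul_le_mul_of_nonneg_right h1 (show 0 ≤ r ^ (2 * j) by positivity)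
    linarith
  · have h1 : ∑ k ∈ Finset.range (j + 1), a k * s ^ (2 * k) ≤ M s :=
      sum_le_hasSum _ (fun k _ => hnn s k) (hM s hs)
    have h2 : (∑ k ∈ Finset.range (j + 1), a k * r ^ (2 * k)) * s ^ (2 * j) ≤
        (∑ k ∈ Finset.range (j + 1), a k * s ^ (2 * k)) * r ^ (2 * j) := by
      rw [Finset.sum_mul, Finset.sum_mul]
      refine Finset.sum_le_sum fun k hk => ?_
      obtain ⟨l, rfl⟩ := Nat.exists_eq_add_of_le (Nat.lt_succ_iff.1 (Finset.mem_range.1 hk))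
      have : s ^ (2 * l) ≤ r ^ (2 * l) := pow_le_pow_left₀ hs.le hrs _
      calc a k * r ^ (2 * k) * s ^ (2 * (k + l))
          = (a k * (r ^ (2 * k) * s ^ (2 * k))) * s ^ (2 * l) := by ring
        _ ≤ (a k * (r ^ (2 * k) * s ^ (2 * k))) * r ^ (2 * l) :=
            mul_le_mul_of_nonneg_left this (mul_nonneg (ha _) (by positivity))
        _ = a k * s ^ (2 * k) * r ^ (2 * (k + l)) := by ring
    have h3 := mul_le_mul_of_nonneg_right hj1 (show 0 ≤ s ^ (2 * j) by positivity)
    have h4 := mul_le_mul_of_nonneg_right h1 (show 0 ≤ r ^ (2 * j) by positivity)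
    linarith

/-- The square root of an even power series with non-negative coefficients is, up to the factor
`√2`, the exponential of a tropical power series in the logarithm of the variable. -/
theorem exists_tropical_of_hasSum {a : ℕ → ℝ} {M : ℝ → ℝ} (ha : ∀ k, 0 ≤ a k)
    (hM : ∀ r, 0 < r → HasSum (fun k => a k * r ^ (2 * k)) (M r))
    (hpos : ∀ r, 0 < r → 0 < M r) :
    ∃ (E : Set ℕ) (b : ℕ → ℝ) (Ψ : ℝ → ℝ), (∀ j ∈ E, a j ≠ 0) ∧
      (∀ x : ℝ, IsLUB ((fun j : ℕ => b j + (j : ℝ) * x) '' E) (Ψ x)) ∧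
      (∀ x, Real.exp (Ψ x) ^ 2 ≤ M (Real.exp x)) ∧
      (∀ x, M (Real.exp x) ≤ 2 * Real.exp (Ψ x) ^ 2) ∧
      ∀ x, a 0 ≤ Real.exp (Ψ x) ^ 2 := by
  set φ : ℝ → ℝ := fun x => Real.log (M (Real.exp x)) / 2 with hφ
  have hφM : ∀ x, M (Real.exp x) = Real.exp (φ x) ^ 2 := fun x => by
    rw [← Real.exp_nat_mul, hφ]
    rw [show ((2 : ℕ) : ℝ) * (Real.log (M (Real.exp x)) / 2) = Real.log (M (Real.exp x)) by
      push_cast; ring, Real.exp_log (hpos _ (Real.exp_pos x))]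
  have hmed : ∀ x, ∃ j ∈ {j | a j ≠ 0}, ∀ y, φ x - j * x ≤ φ y - j * y + Real.log 2 / 2 := by
    intro x
    obtain ⟨j, hj, hjs⟩ := exists_median_power ha hM hpos (Real.exp_pos x)
    refine ⟨j, hj, fun y => ?_⟩
    have h1 := hjs _ (Real.exp_pos y)
    have h2 := Real.log_le_log
      (mul_pos (hpos _ (Real.exp_pos x)) (pow_pos (Real.exp_pos y) _)) h1
    rw [Real.log_mul (hpos _ (Real.exp_pos x)).ne' (by positivity),
      Real.log_mul (mul_pos two_pos (hpos _ (Real.exp_pos y))).ne' (by positivity),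
      Real.log_mul two_ne_zero (hpos _ (Real.exp_pos y)).ne', Real.log_pow, Real.log_pow,
      Real.log_exp, Real.log_exp] at h2
    push_cast at h2
    simp only [hφ]
    linarith
  obtain ⟨E, b, Ψ, hEJ, hlub, hle, hge, hmax⟩ := exists_tropical_minorant hmed
  refine ⟨E, b, Ψ, hEJ, hlub, fun x => ?_, fun x => ?_, fun x => ?_⟩
  · rw [hφM]
    have := Real.exp_le_exp.2 (hle x)
    gcongr
  · rw [hφM, ← Real.exp_nat_mul, ← Real.exp_nat_mul]
    nth_rewrite 1 [← Real.exp_log (two_pos (α := ℝ))]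
    rw [← Real.exp_add, Real.exp_le_exp]
    push_cast
    linarith [hge x]
  · rcases eq_or_ne (a 0) 0 with h0 | h0
    · rw [h0]; positivity
    · have h0' : 0 < a 0 := lt_of_le_of_ne (ha 0) h0.symm
      have := hmax 0 h0 (Real.log (a 0) / 2) (fun y => by
        have h3 : a 0 ≤ M (Real.exp y) := by
          have := le_hasSum (hM _ (Real.exp_pos y)) 0 (fun k _ =>
            mul_nonneg (ha k) (by positivity))
          simpa using this
        have := Real.log_le_log h0' h3
        simp only [hφ]
        push_cast
        linarith) x
      rw [← Real.exp_nat_mul, ← Real.log_le_iff_le_exp h0']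
      push_cast at this ⊢
      linarith

/-! ### Thinning out a tropical power series -/

section Lines

variable {E : Set ℕ} {b : ℕ → ℝ} {Ψ : ℝ → ℝ}
  (h : ∀ x : ℝ, IsLUB ((fun j : ℕ => b j + (j : ℝ) * x) '' E) (Ψ x))

include h

theorem line_le {j : ℕ} (hj : j ∈ E) (x : ℝ) : b j + j * x ≤ Ψ x := (h x).1 ⟨j, hj, rfl⟩

/-- The supremum defining a tropical power series is attained: by finiteness at `x + 1`, the values
of the lines at `x` tend to `-∞` as the slope grows. -/
theorem exists_active (x : ℝ) : ∃ j ∈ E, Ψ x = b j + j * x := by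
  have hne : ((fun j : ℕ => b j + (j : ℝ) * x) '' E).Nonempty := (h x).nonempty
  obtain ⟨_, j₀, hj₀, rfl⟩ := hne
  obtain ⟨N, hN⟩ := exists_nat_gt (Ψ (x + 1) - (b j₀ + j₀ * x))
  have hfin : {j | j ∈ E ∧ j ≤ max N j₀}.Finite :=
    (Set.finite_Iic (max N j₀)).subset fun j hj => hj.2
  obtain ⟨j, ⟨hjE, -⟩, hj⟩ := Set.exists_max_image _ (fun j : ℕ => b j + (j : ℝ) * x) hfin
    ⟨j₀, hj₀, le_max_right _ _⟩
  refine ⟨j, hjE, le_antisymm ((h x).2 ?_) (line_le h hjE x)⟩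
  rintro _ ⟨k, hk, rfl⟩
  rcases le_or_gt k (max N j₀) with hkN | hkN
  · exact hj k ⟨hk, hkN⟩
  · have h1 := line_le h hk (x + 1)
    have h2 : (N : ℝ) ≤ k := by exact_mod_cast (le_max_left _ _).trans hkN.le
    have h3 := hj j₀ ⟨hj₀, le_max_right _ _⟩
    simp only at h3 ⊢
    linarith

/-- The set where a given line is within `K` of `Ψ` is an interval. -/
theorem le_line_add_of_between {j : ℕ} {K x y z : ℝ} (hxy : x ≤ y) (hyz : y ≤ z)
    (hx : Ψ x ≤ b j + j * x + K) (hz : Ψ z ≤ b j + j * z + K) : Ψ y ≤ b j + j * y + K := by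
  obtain ⟨i, hi, hiy⟩ := exists_active h y
  have h1 := line_le h hi x
  have h2 := line_le h hi z
  rw [hiy]
  rcases le_total (i : ℝ) j with hij | hij
  · nlinarith [mul_nonneg (sub_nonneg.2 hij) (sub_nonneg.2 hxy)]
  · nlinarith [mul_nonneg (sub_nonneg.2 hij) (sub_nonneg.2 hyz)]

/-- Points of contact of the lines with `Ψ` are ordered like the slopes. -/
theorem tangent_le_tangent {j k : ℕ} (hj : j ∈ E) (hk : k ∈ E) (hjk : j < k) {s t : ℝ}
    (hs : Ψ s = b j + j * s) (ht : Ψ t = b k + k * t) : s ≤ t := by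
  have h1 := line_le h hk s
  have h2 := line_le h hj t
  have h3 : (j : ℝ) < k := by exact_mod_cast hjk
  by_contra! hst
  nlinarith [mul_pos (sub_pos.2 h3) (sub_pos.2 hst)]

/-- Among the active lines, take the one with the largest slope whose interval of `K`-closeness to
`Ψ` meets that of the line `j`. It is strictly steeper than `j` as soon as some active line is,
since the interval of the next active line meets that of `j`, at the point where the two lines cross. -/
theorem exists_next {K : ℝ} (hK : 0 ≤ K) {j : ℕ} (hjE : j ∈ E) {t : ℝ}
    (ht : Ψ t = b j + j * t) :
    ∃ k, (k ∈ E ∧ ∃ s, Ψ s = b k + k * s) ∧ j ≤ k ∧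
      (∃ y, Ψ y ≤ b j + j * y + K ∧ Ψ y ≤ b k + k * y + K) ∧
      (∀ i, (i ∈ E ∧ ∃ s, Ψ s = b i + i * s) →
        (∃ y, Ψ y ≤ b j + j * y + K ∧ Ψ y ≤ b i + i * y + K) → i ≤ k) ∧
      ((∃ i, (i ∈ E ∧ ∃ s, Ψ s = b i + i * s) ∧ j < i) → j < k) := by
  classical
  set P : Set ℕ := {i | (i ∈ E ∧ ∃ s, Ψ s = b i + i * s) ∧
    ∃ y, Ψ y ≤ b j + j * y + K ∧ Ψ y ≤ b i + i * y + K} with hP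
  have hjP : j ∈ P := ⟨⟨hjE, t, ht⟩, t, by linarith, by linarith⟩
  -- a line steeper than `j` bounds the interval of `j` on the right, by `X`; a very steep line
  -- is far below `Ψ` on the left of `X`
  have hbdd : BddAbove P := by
    by_cases hex : ∃ i ∈ E, j < i
    · obtain ⟨i, hi, hji⟩ := hex
      have hji' : (0 : ℝ) < i - j := by
        have : (j : ℝ) < i := by exact_mod_cast hji
        linarith
      set X : ℝ := (b j - b i + K) / (i - j) with hX
      have hXe : (i - j) * X = b j - b i + K := by rw [hX]; field_simp
      obtain ⟨N, hN⟩ := exists_nat_gt (Ψ (X + 1) + K - (b j + j * X))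
      refine ⟨max N j, ?_⟩
      rintro k ⟨⟨hk, -⟩, y, hy1, hy2⟩
      by_contra! hlt
      have hkj : (j : ℝ) ≤ k := by exact_mod_cast ((le_max_right _ _).trans hlt.le)
      have hkN : (N : ℝ) ≤ k := by exact_mod_cast ((le_max_left _ _).trans hlt.le)
      have h1 := line_le h hi y
      have h2 := line_le h hjE y
      have h3 := line_le h hk (X + 1)
      have hyX : y ≤ X := by
        by_contra! hc
        nlinarith [mul_pos hji' (sub_pos.2 hc)]
      nlinarith [mul_nonneg (sub_nonneg.2 hkj) (sub_nonneg.2 hyX)]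
    · push Not at hex
      exact ⟨j, fun k hk => hex k hk.1.1⟩
  have hmem := Nat.sSup_mem ⟨j, hjP⟩ hbdd
  refine ⟨sSup P, hmem.1, le_csSup hbdd hjP, hmem.2, fun i hi hy => le_csSup hbdd ⟨hi, hy⟩, ?_⟩
  intro hex
  obtain ⟨⟨hkE, s, hs⟩, hjk⟩ := Nat.find_spec hex
  have hmin := fun i => Nat.find_min hex (m := i)
  set k := Nat.find hex with hk
  refine lt_of_lt_of_le hjk (le_csSup hbdd ⟨⟨hkE, s, hs⟩, ?_⟩)
  have hjk' : (0 : ℝ) < k - j := by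
    have : (j : ℝ) < k := by exact_mod_cast hjk
    linarith
  -- the two lines cross at `y`, and no other line is active there
  set y : ℝ := (b j - b k) / (k - j) with hy
  have hye : (k - j) * y = b j - b k := by rw [hy]; field_simp
  have hty : t ≤ y := by
    have := line_le h hkE t
    by_contra! hc
    nlinarith [mul_pos hjk' (sub_pos.2 hc)]
  have hys : y ≤ s := by
    have := line_le h hjE s
    by_contra! hc
    nlinarith [mul_pos hjk' (sub_pos.2 hc)]
  obtain ⟨i, hi, hiy⟩ := exists_active h y
  have key : Ψ y ≤ b j + j * y := by
    rcases le_or_gt i j with hij | hij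
    · have h1 : (i : ℝ) ≤ j := by exact_mod_cast hij
      have h2 := line_le h hi t
      rw [hiy]
      nlinarith [mul_nonneg (sub_nonneg.2 h1) (sub_nonneg.2 hty)]
    · have hki : k ≤ i := by
        by_contra! hc
        exact hmin i hc ⟨⟨hi, y, hiy⟩, hij⟩
      have h1 : (k : ℝ) ≤ i := by exact_mod_cast hki
      have h2 := line_le h hi s
      rw [hiy]
      nlinarith [mul_nonneg (sub_nonneg.2 h1) (sub_nonneg.2 hys)]
  exact ⟨y, by linarith, by linarith⟩

end Lines

section Chain

variable {E : Set ℕ} {b : ℕ → ℝ} {Ψ : ℝ → ℝ}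
  (h : ∀ x : ℝ, IsLUB ((fun j : ℕ => b j + (j : ℝ) * x) '' E) (Ψ x)) {K : ℝ}
  {s : ℕ → ℕ} {t : ℕ → ℝ} (hsE : ∀ n, s n ∈ E) (ht : ∀ n, Ψ (t n) = b (s n) + s n * t n)
  {N : ℕ} (hN : ∀ k < N, s k < s (k + 1))
  (hdisj : ∀ n m y, m ≤ N → n + 2 ≤ m → Ψ y ≤ b (s n) + s n * y + K →
    b (s m) + s m * y + K < Ψ y)

include h hsE ht hN hdisj

/-- Going back from a line far to the right to a point near the line `s n`, one has to cross the
intervals of `s (n + 2)`, `s (n + 4)`, …, which are disjoint; each crossing costs at least `K`. -/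
theorem chain_gap_right (hK : 0 ≤ K) (r : ℕ) : ∀ (n m : ℕ) (x : ℝ), n + 2 * r ≤ m → m ≤ N →
    Ψ x ≤ b (s n) + s n * x + K → r * K ≤ Ψ x - (b (s m) + s m * x) := by
  induction r with
  | zero =>
    intro n m x _ _ _
    have := line_le h (hsE m) x
    push_cast; linarith
  | succ r ih =>
    intro n m x hnm hmN hx
    -- at `x` the line `s (n + 2)` is `K` below `Ψ`, at its point of contact it is equal to `Ψ`
    have hd := hdisj n (n + 2) x (by omega) le_rfl hx
    have hmono : s (n + 2) ≤ s m := by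
      have : ∀ k, n + 2 + k ≤ N → s (n + 2) ≤ s (n + 2 + k) := by
        intro k
        induction k with
        | zero => simp
        | succ k ihk => exact fun hk => (ihk (by omega)).trans (hN _ (by omega)).le
      obtain ⟨k, rfl⟩ := Nat.exists_eq_add_of_le (show n + 2 ≤ m by omega)
      exact this k hmN
    have hmono' : (s (n + 2) : ℝ) ≤ s m := by exact_mod_cast hmono
    have hxt : x < t (n + 2) := by
      by_contra! hc
      have h1 : t n ≤ t (n + 2) := tangent_le_tangent h (hsE _) (hsE _)
        ((hN n (by omega)).trans (hN (n + 1) (by omega))) (ht n) (ht _)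
      have h2 := le_line_add_of_between h h1 hc (by linarith [ht n]) hx
      have := hdisj n (n + 2) _ (by omega) le_rfl h2
      linarith [ht (n + 2)]
    have h3 := ih (n + 2) m (t (n + 2)) (by omega) hmN (by linarith [ht (n + 2)])
    have h4 := ht (n + 2)
    push_cast
    nlinarith [mul_nonneg (sub_nonneg.2 hmono') (sub_nonneg.2 hxt.le)]

theorem chain_gap_left (hK : 0 ≤ K) (r : ℕ) : ∀ (n m : ℕ) (x : ℝ), m + 2 * r ≤ n → n ≤ N →
    Ψ x ≤ b (s n) + s n * x + K → r * K ≤ Ψ x - (b (s m) + s m * x) := by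
  induction r with
  | zero =>
    intro n m x _ _ _
    have := line_le h (hsE m) x
    push_cast; linarith
  | succ r ih =>
    intro n' m x hnm hmN hx
    obtain ⟨n, rfl⟩ := Nat.exists_eq_add_of_le (show 2 ≤ n' by omega)
    rw [Nat.add_comm 2 n] at hx hnm hmN
    have hd : b (s n) + s n * x + K < Ψ x := by
      by_contra! hc
      linarith [hdisj n (n + 2) x (by omega) le_rfl hc]
    have hmono : s m ≤ s n := by
      have : ∀ k, m + k ≤ N → s m ≤ s (m + k) := by
        intro k
        induction k with
        | zero => simp
        | succ k ihk => exact fun hk => (ihk (by omega)).trans (hN _ (by omega)).le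
      obtain ⟨k, rfl⟩ := Nat.exists_eq_add_of_le (show m ≤ n by omega)
      exact this k (by omega)
    have hmono' : (s m : ℝ) ≤ s n := by exact_mod_cast hmono
    have hxt : t n < x := by
      by_contra! hc
      have h1 : t n ≤ t (n + 2) := tangent_le_tangent h (hsE _) (hsE _)
        ((hN n (by omega)).trans (hN (n + 1) (by omega))) (ht n) (ht _)
      have h2 := le_line_add_of_between h hc h1 hx (by linarith [ht (n + 2)])
      have := hdisj n (n + 2) _ (by omega) le_rfl (show Ψ (t n) ≤ _ by linarith [ht n])
      linarith
    have h3 := ih n m (t n) (by omega) (by omega) (by linarith [ht n])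
    have h4 := ht n
    push_cast
    nlinarith [mul_nonneg (sub_nonneg.2 hmono') (sub_nonneg.2 hxt.le)]

end Chain

/-- Any tropical power series contains a sub-family `A` of lines, ranked by `ρ`, such that at every
point some line `j` of `A` is within `K` of the sup, while the line of rank distance `2 r` or more
from `j` is at least `r K` below the sup. The family is the orbit of the smallest active slope under
the greedy choice of `exists_next`. -/
theorem exists_thinning {E : Set ℕ} {b : ℕ → ℝ} {Ψ : ℝ → ℝ}
    (h : ∀ x : ℝ, IsLUB ((fun j : ℕ => b j + (j : ℝ) * x) '' E) (Ψ x)) {K : ℝ} (hK : 0 ≤ K) :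
    ∃ (A : Set ℕ) (ρ : ℕ → ℕ), A ⊆ E ∧ Set.InjOn ρ A ∧ ∀ x, ∃ j ∈ A, Ψ x ≤ b j + j * x + K ∧
      ∀ i ∈ A, ∀ r : ℕ, (ρ i + 2 * r ≤ ρ j ∨ ρ j + 2 * r ≤ ρ i) →
        r * K ≤ Ψ x - (b i + i * x) := by
  classical
  set P : ℕ → Prop := fun i => i ∈ E ∧ ∃ s, Ψ s = b i + i * s with hP
  have hex : ∃ i, P i := by
    obtain ⟨j, hj, hjx⟩ := exists_active h 0
    exact ⟨j, hj, 0, hjx⟩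
  choose! next hnP hnle hnint hnmax hnlt using
    fun (j : ℕ) (hj : P j) => exists_next h hK hj.1 hj.2.choose_spec
  set s : ℕ → ℕ := fun n => next^[n] (Nat.find hex) with hs
  have hs1 : ∀ n, s (n + 1) = next (s n) := fun n => Function.iterate_succ_apply' _ _ _
  have hsP : ∀ n, P (s n) := by
    intro n
    induction n with
    | zero => exact Nat.find_spec hex
    | succ n ih => rw [hs1]; exact hnP _ ih
  have hmono : Monotone s := monotone_nat_of_le_succ fun n => by
    rw [hs1]; exact hnle _ (hsP n)
  -- `s` is strictly increasing until it reaches the largest active slope, if there is one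
  have hstat : ∀ n, s (n + 1) = s n → ∀ k, s (n + k) = s n := by
    intro n hn k
    induction k with
    | zero => rfl
    | succ k ih => rw [← add_assoc, hs1, ih, ← hs1, hn]
  choose t ht using fun n => (hsP n).2
  -- the rank of `j` is the first index at which it occurs
  set ρ : ℕ → ℕ := fun j => sInf {n | s n = j} with hρ
  have hρs : ∀ j ∈ Set.range s, s (ρ j) = j := fun j hj => Nat.sInf_mem (s := {n | s n = j}) hj
  have hstrict : ∀ j ∈ Set.range s, ∀ k < ρ j, s k < s (k + 1) := by
    intro j hj k hk
    refine lt_of_le_of_ne (hmono (Nat.le_succ k)) fun he => ?_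
    obtain ⟨l, hl⟩ := Nat.exists_eq_add_of_le hk.le
    have h1 := hstat k he.symm l
    rw [← hl, hρs j hj] at h1
    exact absurd (Nat.sInf_le (s := {n | s n = j}) h1.symm) (not_le.2 hk)
  have hcover : ∀ x, ∃ n, Ψ x ≤ b (s n) + s n * x + K := by
    intro x
    obtain ⟨k, hkE, hkx⟩ := exists_active h x
    have hkP : P k := ⟨hkE, x, hkx⟩
    by_cases hall : ∃ n, k < s n
    · have hn := Nat.find_spec hall
      have hmin := fun i => Nat.find_min hall (m := i)
      obtain ⟨n, hn0⟩ : ∃ n, Nat.find hall = n + 1 := by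
        refine Nat.exists_eq_succ_of_ne_zero fun h0 => ?_
        rw [h0] at hn
        exact absurd (Nat.find_min' hex hkP) (not_le.2 hn)
      rw [hn0] at hn
      have hnk : s n ≤ k := not_lt.1 (hmin n (by omega))
      obtain ⟨y, hy1, hy2⟩ := hnint _ (hsP n)
      rw [← hs1] at hy2
      -- the intervals of `s n` and `s (n + 1)` meet at `y`, so together they cover `[t n, t (n + 1)]`
      rcases hnk.eq_or_lt with he | hlt
      · exact ⟨n, by rw [he]; linarith⟩
      · have h1 := tangent_le_tangent h (hsP n).1 hkE hlt (ht n) hkx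
        have h2 := tangent_le_tangent h hkE (hsP (n + 1)).1 hn hkx (ht (n + 1))
        rcases le_total x y with hxy | hxy
        · exact ⟨n, le_line_add_of_between h h1 hxy (by linarith [ht n]) hy1⟩
        · exact ⟨n + 1, le_line_add_of_between h hxy h2 hy2 (by linarith [ht (n + 1)])⟩
    · push Not at hall
      obtain ⟨n, hn⟩ : ∃ n, s (n + 1) = s n := by
        by_contra! hne
        have hsm : StrictMono s := strictMono_nat_of_lt_succ fun n =>
          lt_of_le_of_ne (hmono (Nat.le_succ n)) (hne n).symm
        have := hsm.id_le (k + 1)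
        have := hall (k + 1)
        simp only [id] at *
        omega
      refine ⟨n, ?_⟩
      have hkn : s n = k := by
        refine le_antisymm (hall n) ?_
        by_contra! hc
        have := hnlt _ (hsP n) ⟨k, hkP, hc⟩
        rw [← hs1, hn] at this
        exact lt_irrefl _ this
      rw [hkn]; linarith
  refine ⟨Set.range s, ρ, ?_, ?_, fun x => ?_⟩
  · rintro _ ⟨n, rfl⟩
    exact (hsP n).1
  · intro i hi j hj hij
    rw [← hρs i hi, ← hρs j hj, hij]
  · obtain ⟨n, hn⟩ := hcover x
    have hj : s n ∈ Set.range s := ⟨n, rfl⟩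
    refine ⟨s n, hj, hn, fun i hi r hr => ?_⟩
    set N := max (ρ i) (ρ (s n)) with hNdef
    have hN : ∀ k < N, s k < s (k + 1) := by
      intro k hk
      rcases lt_max_iff.1 hk with hk | hk
      · exact hstrict i hi k hk
      · exact hstrict _ hj k hk
    have hdisj : ∀ n m y, m ≤ N → n + 2 ≤ m → Ψ y ≤ b (s n) + s n * y + K →
        b (s m) + s m * y + K < Ψ y := by
      intro n m y hm hnm hy
      by_contra! hc
      have h1 := hnmax _ (hsP n) (s m) (hsP m) ⟨y, hy, hc⟩
      rw [← hs1] at h1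
      have h2 := hN (m - 1) (by omega)
      have h3 : s (n + 1) ≤ s (m - 1) := hmono (by omega)
      rw [Nat.sub_add_cancel (by omega)] at h2
      omega
    have hn' : Ψ x ≤ b (s (ρ (s n))) + s (ρ (s n)) * x + K := by rwa [hρs _ hj]
    have hE : ∀ n, s n ∈ E := fun n => (hsP n).1
    rw [← hρs i hi]
    rcases hr with hr | hr
    · exact chain_gap_left h hE ht hN hdisj hK r _ _ x hr (le_max_right _ _) hn'
    · exact chain_gap_right h hE ht hN hdisj hK r _ _ x hr (le_max_left _ _) hn'

theorem summable_pow_natAbs {η : ℝ} (h0 : 0 ≤ η) (h1 : η < 1) :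
    Summable fun z : ℤ => η ^ z.natAbs :=
  Summable.of_nat_of_neg (by simpa using summable_geometric_of_lt_one h0 h1)
    (by simpa using summable_geometric_of_lt_one h0 h1)

/-- A tropical power series can be thinned out and split into `J` colour classes of terms
`β i * rⁱ`, `r = eˣ`, with the sum of all the terms bounded by `C e^Ψ`, such that at each point one
term is comparable to `e^Ψ` and dominates all the other terms of its colour. The numbers `J` and `C`
depend only on the required ratio `ε`. -/
theorem exists_lacunary_split {ε : ℝ} (hε : 0 < ε) : ∃ (J : ℕ) (C : ℝ), 0 < C ∧
    ∀ (E : Set ℕ) (b : ℕ → ℝ) (Ψ : ℝ → ℝ),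
      (∀ x : ℝ, IsLUB ((fun j : ℕ => b j + (j : ℝ) * x) '' E) (Ψ x)) →
      ∃ (β : ℕ → ℝ) (σ : ℕ → Fin J), (∀ j, 0 ≤ β j) ∧ (∀ j, β j ≠ 0 → j ∈ E) ∧
        ∀ x, Summable (fun i => β i * Real.exp x ^ i) ∧
          ∑' i, β i * Real.exp x ^ i ≤ C * Real.exp (Ψ x) ∧
          ∃ j, Real.exp (-2) * Real.exp (Ψ x) ≤ β j * Real.exp x ^ j ∧
            ∀ T : Finset ℕ, (∀ i ∈ T, i ≠ j ∧ σ i = σ j) →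
              ∑ i ∈ T, β i * Real.exp x ^ i ≤ ε * Real.exp (Ψ x) := by
  classical
  -- thinning with `K = 2`, the term of rank distance `d` is at most `e^(1 - d) = e η^(2 d)` times
  -- the sup; one factor `η^d` makes the sum converge, the other one makes it small for `d > J`
  set η : ℝ := Real.exp (-(1 / 2)) with hη
  have hη0 : 0 < η := Real.exp_pos _
  have hη1 : η < 1 := by rw [hη, Real.exp_lt_one_iff]; norm_num
  have hsum := summable_pow_natAbs hη0.le hη1
  set S : ℝ := ∑' z : ℤ, η ^ z.natAbs with hS
  have hS0 : 0 ≤ S := tsum_nonneg fun z => by positivity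
  obtain ⟨J, hJ⟩ := exists_pow_lt_of_lt_one (show 0 < ε / (Real.exp 1 * S + 1) by positivity) hη1
  have hJε : Real.exp 1 * S * η ^ (J + 1) ≤ ε := by
    rw [lt_div_iff₀ (by positivity)] at hJ
    have : η ^ (J + 1) ≤ η ^ J := pow_le_pow_of_le_one hη0.le hη1.le (Nat.le_succ J)
    have h2 : 0 ≤ Real.exp 1 * S := by positivity
    nlinarith [pow_pos hη0 J]
  refine ⟨J + 1, Real.exp 1 * S + 1, by positivity, fun E b Ψ h => ?_⟩
  obtain ⟨A, ρ, hAE, hinj, hA⟩ := exists_thinning h (K := 2) (by norm_num)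
  refine ⟨fun j => if j ∈ A then Real.exp (b j) else 0, fun j => Fin.ofNat (J + 1) (ρ j),
    fun j => by dsimp only; split_ifs <;> positivity, fun j hj => ?_, fun x => ?_⟩
  · by_contra hc
    exact hj (if_neg fun hjA => hc (hAE hjA))
  obtain ⟨j, hjA, hj, hgap⟩ := hA x
  have hterm : ∀ i ∈ A, Real.exp (b i) * Real.exp x ^ i = Real.exp (b i + i * x) := fun i _ => by
    rw [Real.exp_add, Real.exp_nat_mul]
  -- the terms decay geometrically in the distance of the ranks
  have hdecay : ∀ i ∈ A, Real.exp (b i) * Real.exp x ^ i ≤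
      Real.exp 1 * Real.exp (Ψ x) *
        (η ^ ((ρ i : ℤ) - ρ j).natAbs * η ^ ((ρ i : ℤ) - ρ j).natAbs) := by
    intro i hi
    rw [hterm i hi, ← mul_pow, hη, ← Real.exp_add (-(1 / 2)), ← Real.exp_nat_mul, ← Real.exp_add,
      ← Real.exp_add, Real.exp_le_exp]
    set d := ((ρ i : ℤ) - ρ j).natAbs with hd
    have := hgap i hi (d / 2) (by omega)
    have h2 : (d : ℝ) ≤ 2 * (d / 2 : ℕ) + 1 := by
      have : d ≤ 2 * (d / 2) + 1 := by omega
      exact_mod_cast this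
    linarith
  have hbound : ∀ T : Finset ℕ, (∀ i ∈ T, i ∈ A) →
      ∑ i ∈ T, η ^ ((ρ i : ℤ) - ρ j).natAbs ≤ S := by
    intro T hT
    have hinj' : Set.InjOn (fun i => (ρ i : ℤ) - ρ j) T := by
      intro i hi k hk hik
      exact hinj (hT i hi) (hT k hk) (by simp only at hik; omega)
    rw [← Finset.sum_image (f := fun z : ℤ => η ^ z.natAbs) hinj']
    exact hsum.sum_le_tsum _ fun z _ => by positivity
  have hfilter : ∀ T : Finset ℕ, ∑ i ∈ T, (if i ∈ A then Real.exp (b i) else 0) * Real.exp x ^ i =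
      ∑ i ∈ T with i ∈ A, Real.exp (b i) * Real.exp x ^ i := by
    intro T
    rw [Finset.sum_filter]
    exact Finset.sum_congr rfl fun i _ => by split_ifs <;> simp
  have hall : ∀ T : Finset ℕ, ∑ i ∈ T, (if i ∈ A then Real.exp (b i) else 0) * Real.exp x ^ i ≤
      (Real.exp 1 * S + 1) * Real.exp (Ψ x) := by
    intro T
    rw [hfilter]
    calc ∑ i ∈ T with i ∈ A, Real.exp (b i) * Real.exp x ^ i
        ≤ ∑ i ∈ T with i ∈ A, Real.exp 1 * Real.exp (Ψ x) * η ^ ((ρ i : ℤ) - ρ j).natAbs := by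
          refine Finset.sum_le_sum fun i hi => (hdecay i (Finset.mem_filter.1 hi).2).trans ?_
          refine mul_le_mul_of_nonneg_left ?_ (by positivity)
          exact mul_le_of_le_one_left (by positivity) (pow_le_one₀ hη0.le hη1.le)
      _ = Real.exp 1 * Real.exp (Ψ x) * ∑ i ∈ T with i ∈ A, η ^ ((ρ i : ℤ) - ρ j).natAbs := by
          rw [Finset.mul_sum]
      _ ≤ Real.exp 1 * Real.exp (Ψ x) * S := by
          refine mul_le_mul_of_nonneg_left (hbound _ fun i hi => ?_) (by positivity)
          exact (Finset.mem_filter.1 hi).2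
      _ ≤ _ := by nlinarith [Real.exp_pos (Ψ x)]
  have hsumm : Summable (fun i => (if i ∈ A then Real.exp (b i) else 0) * Real.exp x ^ i) :=
    summable_of_sum_le (fun i => by split_ifs <;> positivity) hall
  refine ⟨hsumm, hsumm.tsum_le_of_sum_le hall, j, ?_, fun T hT => ?_⟩
  · simp only [if_pos hjA]
    rw [hterm j hjA, ← Real.exp_add, Real.exp_le_exp]
    linarith
  · rw [hfilter]
    calc ∑ i ∈ T with i ∈ A, Real.exp (b i) * Real.exp x ^ i
        ≤ ∑ i ∈ T with i ∈ A, Real.exp 1 * Real.exp (Ψ x) * η ^ (J + 1) *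
            η ^ ((ρ i : ℤ) - ρ j).natAbs := by
          refine Finset.sum_le_sum fun i hi => ?_
          obtain ⟨hiT, hiA⟩ := Finset.mem_filter.1 hi
          refine (hdecay i hiA).trans ?_
          rw [mul_assoc (Real.exp 1 * Real.exp (Ψ x))]
          refine mul_le_mul_of_nonneg_left ?_ (by positivity)
          refine mul_le_mul_of_nonneg_right ?_ (by positivity)
          refine pow_le_pow_of_le_one hη0.le hη1.le ?_
          -- equal colours and different ranks force the ranks to be far apart
          have hne : ρ i ≠ ρ j := fun he => (hT i hiT).1 (hinj hiA hjA he)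
          have hmod : ρ i % (J + 1) = ρ j % (J + 1) := by
            simpa [Fin.ofNat, Fin.ext_iff] using (hT i hiT).2
          have hdvd : ((J + 1 : ℕ) : ℤ) ∣ (ρ i : ℤ) - ρ j :=
            (Nat.modEq_iff_dvd.1 (show ρ j ≡ ρ i [MOD J + 1] from hmod.symm))
          have := Int.natAbs_le_of_dvd_ne_zero hdvd (by omega)
          omega
      _ = Real.exp 1 * Real.exp (Ψ x) * η ^ (J + 1) *
            ∑ i ∈ T with i ∈ A, η ^ ((ρ i : ℤ) - ρ j).natAbs := by rw [Finset.mul_sum]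
      _ ≤ Real.exp 1 * Real.exp (Ψ x) * η ^ (J + 1) * S := by
          refine mul_le_mul_of_nonneg_left (hbound _ fun i hi => ?_) (by positivity)
          exact (Finset.mem_filter.1 hi).2
      _ = Real.exp 1 * S * η ^ (J + 1) * Real.exp (Ψ x) := by ring
      _ ≤ ε * Real.exp (Ψ x) := mul_le_mul_of_nonneg_right hJε (Real.exp_pos _).le

/-! ### Series of holomorphic maps -/

section HolomorphicSeries

variable {X : Type} [NormedAddCommGroup X] [NormedSpace ℂ X]

/-- Cauchy's estimate, applied on the complex lines through `x`. -/
theorem norm_fderiv_le_of_forall_ball {V : Type} [NormedAddCommGroup V] [NormedSpace ℂ V]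
    [CompleteSpace V] {f : X → V} (hf : Differentiable ℂ f) {R u : ℝ}
    (hu : ∀ x, ‖x‖ ≤ R + 1 → ‖f x‖ ≤ u) {x : X} (hx : ‖x‖ ≤ R) : ‖fderiv ℂ f x‖ ≤ u := by
  have hu0 : 0 ≤ u := (norm_nonneg _).trans (hu x (by linarith))
  refine ContinuousLinearMap.opNorm_le_bound _ hu0 fun v => ?_
  rcases eq_or_ne v 0 with rfl | hv
  · simp
  have hv' : 0 < ‖v‖ := norm_pos_iff.2 hv
  have hline : ∀ ζ : ℂ, HasDerivAt (fun ζ : ℂ => x + ζ • v) v ζ := fun ζ => by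
    simpa using ((hasDerivAt_id ζ).smul_const v).const_add x
  have hd : HasDerivAt (fun ζ : ℂ => f (x + ζ • v)) (fderiv ℂ f x v) 0 := by
    have h1 : HasFDerivAt f (fderiv ℂ f x) (x + (0 : ℂ) • v) := by
      simpa using (hf x).hasFDerivAt
    exact h1.comp_hasDerivAt (0 : ℂ) (hline 0)
  have hdiff : Differentiable ℂ fun ζ : ℂ => f (x + ζ • v) :=
    hf.comp fun ζ => (hline ζ).differentiableAt
  have := Complex.norm_deriv_le_of_forall_mem_sphere_norm_le (c := 0) (R := 1 / ‖v‖) (C := u)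
    (by positivity) hdiff.diffContOnCl fun ζ hζ => by
      refine hu _ ((norm_add_le _ _).trans ?_)
      rw [norm_smul, mem_sphere_zero_iff_norm.1 hζ, one_div_mul_cancel hv'.ne']
      linarith
  rw [hd.deriv] at this
  simpa [div_eq_mul_inv] using this

theorem contDiff_tsum_of_summable_on_balls {V : Type} [NormedAddCommGroup V] [NormedSpace ℂ V]
    [CompleteSpace V] {W : ℕ → X → V} (hW : ∀ n, ContDiff ℂ ∞ (W n))
    (hb : ∀ R : ℝ, ∃ u : ℕ → ℝ, Summable u ∧ ∀ n x, ‖x‖ ≤ R → ‖W n x‖ ≤ u n) :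
    ContDiff ℂ ∞ fun x => ∑' n, W n x := by
  rw [contDiff_infty]
  intro m
  induction m generalizing V with
  | zero =>
    rw [Nat.cast_zero, contDiff_zero]
    refine continuous_iff_continuousAt.2 fun x => ?_
    obtain ⟨u, hu, hub⟩ := hb (‖x‖ + 1)
    have := continuousOn_tsum (s := Metric.ball x 1) (fun n => (hW n).continuous.continuousOn) hu
      fun n y hy => hub n y (by
        have := norm_le_norm_add_norm_sub x y
        rw [mem_ball_iff_norm'] at hy
        linarith)
    exact this.continuousAt (Metric.ball_mem_nhds x one_pos)
  | succ m ih =>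
    have hder : ∀ x, HasFDerivAt (fun x => ∑' n, W n x) (∑' n, fderiv ℂ (W n) x) x := by
      intro x
      obtain ⟨u, hu, hub⟩ := hb (‖x‖ + 1 + 1)
      let _ : NormedSpace ℝ X := NormedSpace.restrictScalars ℝ ℂ X
      refine hasFDerivAt_tsum_of_isPreconnected (s := Metric.ball x 1) hu Metric.isOpen_ball
        (convex_ball x 1).isPreconnected
        (fun n y _ => ((hW n).differentiable (by simp) y).hasFDerivAt) (fun n y hy => ?_)
        (Metric.mem_ball_self one_pos) ?_ (Metric.mem_ball_self one_pos)
      · refine norm_fderiv_le_of_forall_ball (R := ‖x‖ + 1) ((hW n).differentiable (by simp))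
          (hub n) ?_
        have := norm_le_norm_add_norm_sub x y
        rw [mem_ball_iff_norm'] at hy
        linarith
      · exact Summable.of_norm_bounded hu fun n => hub n x (by linarith)
    rw [Nat.cast_add, Nat.cast_one, contDiff_succ_iff_fderiv]
    refine ⟨fun x => (hder x).differentiableAt, by simp, ?_⟩
    rw [show fderiv ℂ (fun x => ∑' n, W n x) = fun x => ∑' n, fderiv ℂ (W n) x from
      funext fun x => (hder x).fderiv]
    refine ih (fun n => (contDiff_infty_iff_fderiv.1 (hW n)).2) fun R => ?_
    obtain ⟨u, hu, hub⟩ := hb (R + 1)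
    exact ⟨u, hu, fun n x hx =>
      norm_fderiv_le_of_forall_ball ((hW n).differentiable (by simp)) (hub n) hx⟩

/-- Replace the monomials `exp (ξ z) ^ j` of the colour classes of `exists_lacunary_split` by
holomorphic maps `G j` of comparable size, up to a common factor `τ z`. In the component of the
dominating term nothing can cancel it, so the sums have size `τ z * exp (Ψ (ξ z))`. The constants do
not depend on the tropical series nor on the maps `G j`. -/
theorem exists_holomorphic_assembly {δ C₀ : ℝ} (hδ : 0 < δ) (hC₀ : 0 < C₀) :
    ∃ (J : ℕ) (c C : ℝ), 0 < c ∧ 0 < C ∧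
      ∀ (V : Type) [NormedAddCommGroup V] [NormedSpace ℂ V] [CompleteSpace V]
        (E : Set ℕ) (b : ℕ → ℝ) (Ψ : ℝ → ℝ),
      (∀ x : ℝ, IsLUB ((fun j : ℕ => b j + (j : ℝ) * x) '' E) (Ψ x)) →
      ∀ (G : ℕ → X → V) (D : Set X) (τ ξ : X → ℝ), (∀ j, ContDiff ℂ ∞ (G j)) →
      (∀ z ∈ D, 0 ≤ τ z) →
      (∀ j ∈ E, ∀ z ∈ D, δ * (τ z * Real.exp (ξ z) ^ j) ≤ ‖G j z‖ ∧
        ‖G j z‖ ≤ C₀ * (τ z * Real.exp (ξ z) ^ j)) →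
      (∀ R : ℝ, ∃ y T : ℝ, ∀ j ∈ E, ∀ z, ‖z‖ ≤ R → ‖G j z‖ ≤ T * Real.exp y ^ j) →
      ∃ F : X → (Fin J → V), ContDiff ℂ ∞ F ∧ ∀ z ∈ D,
        c * (τ z * Real.exp (Ψ (ξ z))) ≤ ‖F z‖ ∧ ‖F z‖ ≤ C * (τ z * Real.exp (Ψ (ξ z))) := by
  classical
  obtain ⟨J, C, hC, hsplit⟩ := exists_lacunary_split
    (show 0 < δ * Real.exp (-2) / (2 * C₀) by positivity)
  refine ⟨J, δ * Real.exp (-2) / 2, C₀ * C, by positivity, by positivity, ?_⟩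
  intro V _ _ _ E b Ψ hlub G D τ ξ hG hτ hGD hball
  obtain ⟨β, σ, hβ0, hβE, hβ⟩ := hsplit E b Ψ hlub
  set t : Fin J → ℕ → X → V := fun s j z => if σ j = s then (β j : ℂ) • G j z else 0 with ht
  have htn : ∀ s j z, ‖t s j z‖ ≤ β j * ‖G j z‖ := by
    intro s j z
    simp only [ht]
    split_ifs
    · rw [norm_smul, Complex.norm_real, Real.norm_of_nonneg (hβ0 j)]
    · rw [norm_zero]; exact mul_nonneg (hβ0 j) (norm_nonneg _)
  have htD : ∀ s j, ∀ z ∈ D, ‖t s j z‖ ≤ C₀ * τ z * (β j * Real.exp (ξ z) ^ j) := by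
    intro s j z hz
    refine (htn s j z).trans ?_
    by_cases h0 : β j = 0
    · simp [h0]
    · have := mul_le_mul_of_nonneg_left (hGD j (hβE j h0) z hz).2 (hβ0 j)
      linarith
  refine ⟨fun z s => ∑' j, t s j z, contDiff_pi.2 fun s => ?_, fun z hz => ?_⟩
  · refine contDiff_tsum_of_summable_on_balls (fun j => ?_) fun R => ?_
    · simp only [ht]
      by_cases hs : σ j = s
      · simpa [hs] using (hG j).const_smul (β j : ℂ)
      · simpa [hs] using contDiff_const
    · obtain ⟨y, T, hT⟩ := hball R
      refine ⟨fun j => T * (β j * Real.exp y ^ j), (hβ y).1.mul_left T, fun j z hz => ?_⟩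
      refine (htn s j z).trans ?_
      by_cases h0 : β j = 0
      · simp [h0]
      · have := mul_le_mul_of_nonneg_left (hT j (hβE j h0) z hz) (hβ0 j)
        linarith
  obtain ⟨hsum, hle, j, hj, hrest⟩ := hβ (ξ z)
  have hτz := hτ z hz
  have hsn : ∀ s, Summable fun j => ‖t s j z‖ := fun s =>
    Summable.of_nonneg_of_le (fun j => norm_nonneg _) (fun j => htD s j z hz) (hsum.mul_left _)
  constructor
  · have hj0 : β j ≠ 0 := fun h0 => by
      rw [h0, zero_mul] at hj
      exact absurd hj (not_le.2 (by positivity))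
    refine le_trans ?_ (norm_le_pi_norm _ (σ j))
    simp only
    have hmain : δ * Real.exp (-2) * (τ z * Real.exp (Ψ (ξ z))) ≤ ‖t (σ j) j z‖ := by
      simp only [ht, if_true]
      rw [norm_smul, Complex.norm_real, Real.norm_of_nonneg (hβ0 j)]
      calc δ * Real.exp (-2) * (τ z * Real.exp (Ψ (ξ z)))
          = δ * τ z * (Real.exp (-2) * Real.exp (Ψ (ξ z))) := by ring
        _ ≤ δ * τ z * (β j * Real.exp (ξ z) ^ j) :=
            mul_le_mul_of_nonneg_left hj (by positivity)
        _ = β j * (δ * (τ z * Real.exp (ξ z) ^ j)) := by ring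
        _ ≤ β j * ‖G j z‖ := mul_le_mul_of_nonneg_left (hGD j (hβE j hj0) z hz).1 (hβ0 j)
    have hothers : ‖∑' i, (if i = j then 0 else t (σ j) i z)‖ ≤
        δ * Real.exp (-2) / 2 * (τ z * Real.exp (Ψ (ξ z))) := by
      have hle' : ∀ i, ‖if i = j then 0 else t (σ j) i z‖ ≤ ‖t (σ j) i z‖ := fun i => by
        split_ifs <;> simp
      have hs' := Summable.of_nonneg_of_le (fun i => norm_nonneg _) hle' (hsn (σ j))
      refine (norm_tsum_le_tsum_norm hs').trans (hs'.tsum_le_of_sum_le fun T => ?_)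
      calc ∑ i ∈ T, ‖if i = j then 0 else t (σ j) i z‖
          = ∑ i ∈ T with i ≠ j ∧ σ i = σ j, ‖t (σ j) i z‖ := by
            rw [Finset.sum_filter]
            refine Finset.sum_congr rfl fun i _ => ?_
            by_cases h1 : i = j
            · simp [h1]
            · by_cases h2 : σ i = σ j
              · simp [h1, h2]
              · simp [ht, h1, h2]
        _ ≤ ∑ i ∈ T with i ≠ j ∧ σ i = σ j, C₀ * τ z * (β i * Real.exp (ξ z) ^ i) :=
            Finset.sum_le_sum fun i _ => htD _ i z hz
        _ = C₀ * τ z * ∑ i ∈ T with i ≠ j ∧ σ i = σ j, β i * Real.exp (ξ z) ^ i := by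
            rw [Finset.mul_sum]
        _ ≤ C₀ * τ z * (δ * Real.exp (-2) / (2 * C₀) * Real.exp (Ψ (ξ z))) :=
            mul_le_mul_of_nonneg_left (hrest _ fun i hi => (Finset.mem_filter.1 hi).2)
              (by positivity)
        _ = _ := by field_simp
    have hsplit2 := (hsn (σ j)).of_norm.tsum_eq_add_tsum_ite j
    rw [hsplit2]
    have := norm_sub_le_norm_add (t (σ j) j z) (∑' i, (if i = j then 0 else t (σ j) i z))
    linarith
  · refine (pi_norm_le_iff_of_nonneg (by positivity)).2 fun s => ?_
    refine (norm_tsum_le_tsum_norm (hsn s)).trans ?_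
    calc ∑' j, ‖t s j z‖ ≤ ∑' j, C₀ * τ z * (β j * Real.exp (ξ z) ^ j) :=
          (hsn s).tsum_le_tsum (fun j => htD s j z hz) (hsum.mul_left _)
      _ = C₀ * τ z * ∑' j, β j * Real.exp (ξ z) ^ j := tsum_mul_left
      _ ≤ C₀ * τ z * (C * Real.exp (Ψ (ξ z))) := mul_le_mul_of_nonneg_left hle (by positivity)
      _ = _ := by ring

end HolomorphicSeries

/-! ### Holomorphic maps with prescribed radial growth -/

theorem le_of_le_on_dense {X : Type*} [TopologicalSpace X] {f g : X → ℝ} {D : Set X}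
    (hD : Dense D) (hf : Continuous f) (hg : Continuous g) (h : ∀ z ∈ D, f z ≤ g z) (z : X) :
    f z ≤ g z :=
  closure_minimal (s := D) (t := {z | f z ≤ g z}) h (isClosed_le hf hg) (hD z)

theorem dense_coord_ne_zero {ι : Type*} [Fintype ι] (i : ι) :
    Dense {z : EuclideanSpace ℂ ι | z i ≠ 0} := by
  classical
  have hsurj : Function.Surjective (EuclideanSpace.proj i : EuclideanSpace ℂ ι →L[ℂ] ℂ) :=
    fun c => ⟨EuclideanSpace.single i c, by simp⟩
  exact (dense_compl_singleton (0 : ℂ)).preimage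
    ((EuclideanSpace.proj i : EuclideanSpace ℂ ι →L[ℂ] ℂ).isOpenMap hsurj)

theorem isOpen_coord_ne_zero {ι : Type*} [Fintype ι] (i : ι) :
    IsOpen {z : EuclideanSpace ℂ ι | z i ≠ 0} :=
  isOpen_ne_fun (by fun_prop) continuous_const

/-- The projection `ℂⁿ⁺¹ → ℂⁿ` forgetting the last coordinate. -/
noncomputable def forgetLast (n : ℕ) :
    EuclideanSpace ℂ (Fin (n + 1)) →L[ℂ] EuclideanSpace ℂ (Fin n) :=
  LinearMap.toContinuousLinearMap
    { toFun := fun z => WithLp.toLp 2 fun i => z i.castSucc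
      map_add' := fun _ _ => rfl
      map_smul' := fun _ _ => rfl }

theorem forgetLast_apply (n : ℕ) (z : EuclideanSpace ℂ (Fin (n + 1))) (i : Fin n) :
    forgetLast n z i = z i.castSucc := rfl

theorem norm_sq_eq_forgetLast (n : ℕ) (z : EuclideanSpace ℂ (Fin (n + 1))) :
    ‖z‖ ^ 2 = ‖forgetLast n z‖ ^ 2 + ‖z (Fin.last n)‖ ^ 2 := by
  rw [EuclideanSpace.norm_sq_eq, EuclideanSpace.norm_sq_eq, Fin.sum_univ_castSucc]
  rfl

/-- `(1 + r²) ^ (d / 2)` is a tropical polynomial in `log r`, up to a factor independent of the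
degree `d`. The slopes are at most `d`. -/
theorem exists_tropical_one_add_sq_pow (d : ℕ) :
    ∃ (E : Set ℕ) (b : ℕ → ℝ) (Ψ : ℝ → ℝ), (∀ j ∈ E, j ≤ d) ∧
      (∀ x : ℝ, IsLUB ((fun j : ℕ => b j + (j : ℝ) * x) '' E) (Ψ x)) ∧
      (∀ x, Real.exp (Ψ x) ^ 2 ≤ (1 + Real.exp x ^ 2) ^ d) ∧
      (∀ x, (1 + Real.exp x ^ 2) ^ d ≤ 2 * Real.exp (Ψ x) ^ 2) := by
  obtain ⟨E, b, Ψ, hE, hlub, h1, h2, -⟩ := exists_tropical_of_hasSum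
    (a := fun k => (d.choose k : ℝ)) (M := fun r => (1 + r ^ 2) ^ d) (fun k => by positivity)
    (fun r _ => by
      have : (1 + r ^ 2) ^ d = ∑ k ∈ Finset.range (d + 1), (d.choose k : ℝ) * r ^ (2 * k) := by
        rw [add_comm, add_pow]
        exact Finset.sum_congr rfl fun k _ => by rw [one_pow, mul_one, pow_mul, mul_comm]
      rw [this]
      refine hasSum_sum_of_ne_finset_zero fun k hk => ?_
      rw [Finset.mem_range, not_lt] at hk
      simp [Nat.choose_eq_zero_of_lt (show d < k by omega)])
    (fun r _ => by positivity)
  refine ⟨E, b, Ψ, fun j hj => ?_, hlub, h1, h2⟩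
  by_contra! hc
  exact hE j hj (by simp [Nat.choose_eq_zero_of_lt hc])

/-- In each dimension, the functions `‖z‖ ^ d` are uniformly in `d` comparable to norms of
holomorphic maps into one finite-dimensional space. -/
theorem exists_holomorphic_norm_pow (p : ℕ) :
    ∃ (V : Type) (_ : NormedAddCommGroup V) (_ : NormedSpace ℂ V) (_ : FiniteDimensional ℂ V)
      (δ C : ℝ), 0 < δ ∧ 0 < C ∧ ∀ d : ℕ, ∃ W : EuclideanSpace ℂ (Fin (p + 1)) → V,
        ContDiff ℂ ∞ W ∧ ∀ z, δ * ‖z‖ ^ d ≤ ‖W z‖ ∧ ‖W z‖ ≤ C * ‖z‖ ^ d := by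
  induction p with
  | zero =>
    refine ⟨ℂ, inferInstance, inferInstance, inferInstance, 1, 1, one_pos, one_pos, fun d =>
      ⟨fun z => z 0 ^ d, by fun_prop, fun z => ?_⟩⟩
    have : ‖z‖ = ‖z 0‖ := by simp [EuclideanSpace.norm_eq, Real.sqrt_sq]
    simp [this]
  | succ p ih =>
    obtain ⟨V, _, _, _, δ, C, hδ, hC, hW⟩ := ih
    have : CompleteSpace V := FiniteDimensional.complete ℂ V
    choose W hWc hWb using hW
    obtain ⟨J, c, C', hc, hC', hass⟩ :=
      exists_holomorphic_assembly (X := EuclideanSpace ℂ (Fin (p + 2))) hδ hC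
    refine ⟨Fin J → V, inferInstance, inferInstance, inferInstance, c / 2, C', by positivity, hC',
      fun d => ?_⟩
    obtain ⟨E, b, Ψ, hE, hlub, hΨ1, hΨ2⟩ := exists_tropical_one_add_sq_pow d
    set D : Set (EuclideanSpace ℂ (Fin (p + 2))) :=
      {z | z (Fin.castSucc 0) ≠ 0} ∩ {z | z (Fin.last (p + 1)) ≠ 0} with hD
    have hDd : Dense D := (dense_coord_ne_zero _).inter_of_isOpen_left (dense_coord_ne_zero _)
      (isOpen_coord_ne_zero _)
    -- on the dense set `D`, `log (‖z'‖ / ‖ζ‖)` makes sense, where `z = (z', ζ)`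
    have hlast : ∀ z ∈ D, 0 < ‖z (Fin.last (p + 1))‖ := fun z hz => norm_pos_iff.2 hz.2
    have hinit : ∀ z ∈ D, 0 < ‖forgetLast (p + 1) z‖ := fun z hz => by
      refine norm_pos_iff.2 fun h0 => hz.1 ?_
      rw [← forgetLast_apply, h0]; rfl
    have hle1 : ∀ z, ‖forgetLast (p + 1) z‖ ≤ ‖z‖ := fun z =>
      le_of_sq_le_sq (by nlinarith [norm_sq_eq_forgetLast (p + 1) z]) (norm_nonneg _)
    have hle2 : ∀ z : EuclideanSpace ℂ (Fin (p + 2)), ‖z (Fin.last (p + 1))‖ ≤ ‖z‖ := fun z =>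
      le_of_sq_le_sq (by nlinarith [norm_sq_eq_forgetLast (p + 1) z]) (norm_nonneg _)
    have hexp : ∀ z ∈ D, Real.exp (Real.log (‖forgetLast (p + 1) z‖ / ‖z (Fin.last (p + 1))‖)) =
        ‖forgetLast (p + 1) z‖ / ‖z (Fin.last (p + 1))‖ := fun z hz =>
      Real.exp_log (div_pos (hinit z hz) (hlast z hz))
    have hterm : ∀ j ∈ E, ∀ z ∈ D, ‖z (Fin.last (p + 1))‖ ^ d *
        Real.exp (Real.log (‖forgetLast (p + 1) z‖ / ‖z (Fin.last (p + 1))‖)) ^ j =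
        ‖z (Fin.last (p + 1))‖ ^ (d - j) * ‖forgetLast (p + 1) z‖ ^ j := by
      intro j hj z hz
      have := (hlast z hz).ne'
      obtain ⟨k, rfl⟩ := Nat.exists_eq_add_of_le (hE j hj)
      rw [hexp z hz, Nat.add_sub_cancel_left, div_pow, pow_add]
      field_simp
    obtain ⟨F, hFc, hF⟩ := hass V E b Ψ hlub
      (fun j z => z (Fin.last (p + 1)) ^ (d - j) • W j (forgetLast (p + 1) z)) D
      (fun z => ‖z (Fin.last (p + 1))‖ ^ d)
      (fun z => Real.log (‖forgetLast (p + 1) z‖ / ‖z (Fin.last (p + 1))‖))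
      (fun j => ContDiff.smul (by fun_prop) ((hWc j).comp (forgetLast (p + 1)).contDiff))
      (fun z _ => by positivity)
      (fun j hj z hz => by
        rw [hterm j hj z hz, norm_smul, norm_pow]
        have h1 := hWb j (forgetLast (p + 1) z)
        have h2 : 0 ≤ ‖z (Fin.last (p + 1))‖ ^ (d - j) := by positivity
        constructor
        · have := mul_le_mul_of_nonneg_left h1.1 h2
          linarith
        · have := mul_le_mul_of_nonneg_left h1.2 h2
          linarith)
      (fun R => ⟨0, C * max R 1 ^ d, fun j hj z hz => by
        rw [Real.exp_zero, one_pow, mul_one, norm_smul, norm_pow]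
        have hz' : ‖z‖ ≤ max R 1 := hz.trans (le_max_left _ _)
        calc ‖z (Fin.last (p + 1))‖ ^ (d - j) * ‖W j (forgetLast (p + 1) z)‖
            ≤ max R 1 ^ (d - j) * (C * max R 1 ^ j) := by
              have h1 := (hWb j (forgetLast (p + 1) z)).2
              have h2 := (hle1 z).trans hz'
              have h3 := (hle2 z).trans hz'
              have : ‖W j (forgetLast (p + 1) z)‖ ≤ C * max R 1 ^ j := h1.trans (by gcongr)
              gcongr
          _ = C * max R 1 ^ d := by
              rw [mul_left_comm, ← pow_add, Nat.sub_add_cancel (hE j hj)]⟩)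
    have hcomp : ∀ z ∈ D, ‖z (Fin.last (p + 1))‖ ^ d * Real.exp (Ψ (Real.log
        (‖forgetLast (p + 1) z‖ / ‖z (Fin.last (p + 1))‖))) ≤ ‖z‖ ^ d ∧ ‖z‖ ^ d ≤
        2 * (‖z (Fin.last (p + 1))‖ ^ d * Real.exp (Ψ (Real.log
          (‖forgetLast (p + 1) z‖ / ‖z (Fin.last (p + 1))‖)))) := by
      intro z hz
      have hl := hlast z hz
      have h1 := hΨ1 (Real.log (‖forgetLast (p + 1) z‖ / ‖z (Fin.last (p + 1))‖))
      have h2 := hΨ2 (Real.log (‖forgetLast (p + 1) z‖ / ‖z (Fin.last (p + 1))‖))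
      set e := Real.exp (Ψ (Real.log (‖forgetLast (p + 1) z‖ / ‖z (Fin.last (p + 1))‖))) with he
      have he0 : 0 < e := Real.exp_pos _
      rw [hexp z hz] at h1 h2
      have hz2 : (‖z‖ ^ d) ^ 2 = (‖z (Fin.last (p + 1))‖ ^ d) ^ 2 *
          (1 + (‖forgetLast (p + 1) z‖ / ‖z (Fin.last (p + 1))‖) ^ 2) ^ d := by
        rw [← pow_mul, mul_comm d 2, pow_mul, norm_sq_eq_forgetLast, ← pow_mul, mul_comm d 2,
          pow_mul, ← mul_pow]
        congr 1
        field_simp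
        ring
      constructor
      · refine le_of_sq_le_sq ?_ (by positivity)
        rw [hz2, mul_pow]
        gcongr
      · refine le_of_sq_le_sq ?_ (by positivity)
        rw [hz2]
        calc _ ≤ (‖z (Fin.last (p + 1))‖ ^ d) ^ 2 * (2 * e ^ 2) := by gcongr
          _ ≤ _ := by
            rw [mul_pow, mul_pow]
            nlinarith [show 0 ≤ (‖z (Fin.last (p + 1))‖ ^ d) ^ 2 * e ^ 2 by positivity]
    refine ⟨F, hFc, fun z => ⟨?_, ?_⟩⟩
    · refine le_of_le_on_dense (f := fun z => c / 2 * ‖z‖ ^ d) hDd (by fun_prop)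
        hFc.continuous.norm (fun z hz => ?_) z
      nlinarith [(hcomp z hz).2, (hF z hz).1]
    · refine le_of_le_on_dense (g := fun z => C' * ‖z‖ ^ d) hDd
        hFc.continuous.norm (by fun_prop) (fun z hz => ?_) z
      nlinarith [(hcomp z hz).1, (hF z hz).2]

theorem exp_logTransform_log {v : ℝ≥0 → ℝ} (hv : ∀ t, 0 < v t) {r : ℝ≥0} (hr : r ≠ 0) :
    Real.exp (logTransform v (Real.log r)) = v r := by
  rw [logTransform, Real.exp_log (hv _), Real.exp_log (by positivity), Real.toNNReal_coe]

theorem exists_holomorphic_of_isLogTropicalWeight (p : ℕ) {v : ℝ≥0 → ℝ}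
    (hv : IsLogTropicalWeight v) :
    ∃ (V : Type) (_ : NormedAddCommGroup V) (_ : NormedSpace ℂ V) (_ : FiniteDimensional ℂ V)
      (F : EuclideanSpace ℂ (Fin (p + 1)) → V) (c C : ℝ), 0 < c ∧ 0 < C ∧ ContDiff ℂ ∞ F ∧
        ∀ z, c * v ‖z‖₊ ≤ ‖F z‖ ∧ ‖F z‖ ≤ C * v ‖z‖₊ := by
  obtain ⟨V, _, _, _, δ, C, hδ, hC, hW⟩ := exists_holomorphic_norm_pow p
  have : CompleteSpace V := FiniteDimensional.complete ℂ V
  choose W hWc hWb using hW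
  obtain ⟨J, c, C', hc, hC', hass⟩ :=
    exists_holomorphic_assembly (X := EuclideanSpace ℂ (Fin (p + 1))) hδ hC
  obtain ⟨hvw, E, b, hlub⟩ := hv
  have hexp : ∀ z : EuclideanSpace ℂ (Fin (p + 1)), z ≠ 0 → Real.exp (Real.log ‖z‖) = ‖z‖ :=
    fun z hz => Real.exp_log (norm_pos_iff.2 hz)
  obtain ⟨F, hFc, hF⟩ := hass V E b _ hlub W {0}ᶜ (fun _ => 1) (fun z => Real.log ‖z‖) hWc
    (fun _ _ => zero_le_one)
    (fun j _ z hz => by rw [hexp z hz, one_mul]; exact hWb j z)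
    (fun R => ⟨Real.log (max R 1), C, fun j _ z hz => by
      rw [Real.exp_log (by positivity)]
      refine (hWb j z).2.trans ?_
      have := hz.trans (le_max_left R 1)
      gcongr⟩)
  refine ⟨Fin J → V, inferInstance, inferInstance, inferInstance, F, c, C', hc, hC', hFc, ?_⟩
  have hF' : ∀ z ∈ ({0}ᶜ : Set (EuclideanSpace ℂ (Fin (p + 1)))),
      c * v ‖z‖₊ ≤ ‖F z‖ ∧ ‖F z‖ ≤ C' * v ‖z‖₊ := by
    intro z hz
    have h1 := hF z hz
    have h2 := exp_logTransform_log hvw.pos (r := ‖z‖₊) (nnnorm_ne_zero_iff.2 hz)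
    rw [coe_nnnorm] at h2
    rwa [h2, one_mul] at h1
  have hcont : Continuous fun z : EuclideanSpace ℂ (Fin (p + 1)) => v ‖z‖₊ :=
    hvw.continuous.comp continuous_nnnorm
  exact fun z => ⟨le_of_le_on_dense (dense_compl_singleton 0) (hcont.const_mul c)
    hFc.continuous.norm (fun z hz => (hF' z hz).1) z,
    le_of_le_on_dense (dense_compl_singleton 0) hFc.continuous.norm (hcont.const_mul C')
    (fun z hz => (hF' z hz).2) z⟩

/-! ### Holomorphic maps are harmonic -/

section Complexification

/-- The isometric identification of `ℝᵖ⁺ᵖ` with `ℂᵖ`, `(x, y) ↦ x + i y`. -/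
noncomputable def complexify (p : ℕ) :
    EuclideanSpace ℝ (Fin (p + p)) →L[ℝ] EuclideanSpace ℂ (Fin p) :=
  LinearMap.toContinuousLinearMap
    { toFun := fun x => WithLp.toLp 2 fun i =>
        ((x (Fin.castAdd p i) : ℂ) + (x (Fin.natAdd p i) : ℂ) * Complex.I)
      map_add' := fun x y => by
        ext i
        simp
        ring
      map_smul' := fun c x => by
        ext i
        simp
        ring }

theorem complexify_apply (p : ℕ) (x : EuclideanSpace ℝ (Fin (p + p))) (i : Fin p) :
    complexify p x i = (x (Fin.castAdd p i) : ℂ) + (x (Fin.natAdd p i) : ℂ) * Complex.I := rfl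

theorem norm_complexify (p : ℕ) (x : EuclideanSpace ℝ (Fin (p + p))) : ‖complexify p x‖ = ‖x‖ := by
  rw [EuclideanSpace.norm_eq, EuclideanSpace.norm_eq, Fin.sum_univ_add, ← Finset.sum_add_distrib]
  congr 1
  refine Finset.sum_congr rfl fun i _ => ?_
  rw [complexify_apply, ← Complex.normSq_eq_norm_sq, Complex.normSq_add_mul_I, Real.norm_eq_abs,
    Real.norm_eq_abs, sq_abs, sq_abs]

theorem complexify_single_natAdd (p : ℕ) (i : Fin p) :
    complexify p (EuclideanSpace.single (Fin.natAdd p i) 1) =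
      Complex.I • complexify p (EuclideanSpace.single (Fin.castAdd p i) 1) := by
  ext k
  rw [PiLp.smul_apply, complexify_apply, complexify_apply]
  have h1 : ∀ i k : Fin p, Fin.castAdd p i ≠ Fin.natAdd p k := fun i k => by
    simp only [ne_eq, Fin.ext_iff, Fin.val_castAdd, Fin.val_natAdd]; omega
  have h2 : ∀ i k : Fin p, Fin.natAdd p i = Fin.natAdd p k ↔ i = k := fun i k => by
    simp only [Fin.ext_iff, Fin.val_natAdd]; omega
  have h3 : ∀ i k : Fin p, Fin.castAdd p i = Fin.castAdd p k ↔ i = k := fun i k => by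
    simp only [Fin.ext_iff, Fin.val_castAdd]
  simp only [PiLp.single_apply, h1, (h1 _ _).symm, h2, h3, if_false]
  by_cases h : k = i <;> simp [h]

variable {p : ℕ} {V : Type*} [NormedAddCommGroup V] [NormedSpace ℂ V]

theorem iteratedFDeriv_two_comp_complexify {F : EuclideanSpace ℂ (Fin p) → V}
    (hF : ContDiff ℂ ∞ F) (x u : EuclideanSpace ℝ (Fin (p + p))) :
    iteratedFDeriv ℝ 2 (fun y => F (complexify p y)) x ![u, u] =
      fderiv ℂ (fderiv ℂ F) (complexify p x) (complexify p u) (complexify p u) := by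
  have hd1 : ∀ y v, fderiv ℝ (fun y => F (complexify p y)) y v =
      fderiv ℂ F (complexify p y) (complexify p v) := by
    intro y v
    have h1 : HasFDerivAt F ((fderiv ℂ F (complexify p y)).restrictScalars ℝ) (complexify p y) :=
      ((hF.differentiable (by simp)) _).hasFDerivAt.restrictScalars ℝ
    have h2 := h1.comp y (complexify p).hasFDerivAt
    exact congrArg (fun L => L v) h2.fderiv
  have hF' : Differentiable ℂ (fderiv ℂ F) :=
    (contDiff_infty_iff_fderiv.1 hF).2.differentiable (by simp)
  have hG : HasFDerivAt (fun y => fderiv ℝ (fun y => F (complexify p y)) y u)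
      ((((ContinuousLinearMap.apply ℂ V (complexify p u)).comp
        (fderiv ℂ (fderiv ℂ F) (complexify p x))).restrictScalars ℝ).comp (complexify p)) x := by
    simp only [hd1]
    have h1 : HasFDerivAt (fun z => fderiv ℂ F z (complexify p u))
        ((ContinuousLinearMap.apply ℂ V (complexify p u)).comp
          (fderiv ℂ (fderiv ℂ F) (complexify p x))) (complexify p x) :=
      (ContinuousLinearMap.apply ℂ V (complexify p u)).hasFDerivAt.comp _
        (hF' _).hasFDerivAt
    exact (h1.restrictScalars ℝ).comp x (complexify p).hasFDerivAt
  have hsm : ContDiff ℝ ∞ (fun y => F (complexify p y)) :=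
    (hF.restrict_scalars ℝ).comp (complexify p).contDiff
  have hd2 : DifferentiableAt ℝ (fderiv ℝ (fun y => F (complexify p y))) x :=
    (contDiff_infty_iff_fderiv.1 hsm).2.differentiable (by simp) x
  rw [iteratedFDeriv_two_apply]
  simp only [Matrix.cons_val_zero, Matrix.cons_val_one]
  have h2 : fderiv ℝ (fun y => fderiv ℝ (fun y => F (complexify p y)) y u) x u =
      fderiv ℝ (fderiv ℝ (fun y => F (complexify p y))) x u u := by
    rw [fderiv_clm_apply hd2 (by fun_prop)]
    simp
  rw [← h2, hG.fderiv]
  rfl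

/-- The second derivatives of a holomorphic map along `e` and `i e` cancel. -/
theorem harmonicOnNhd_comp_complexify {F : EuclideanSpace ℂ (Fin p) → V}
    (hF : ContDiff ℂ ∞ F) :
    InnerProductSpace.HarmonicOnNhd (fun y => F (complexify p y)) Set.univ := by
  have hsm : ContDiff ℝ ∞ (fun y => F (complexify p y)) :=
    (hF.restrict_scalars ℝ).comp (complexify p).contDiff
  refine fun x _ => ⟨(contDiff_infty.1 hsm 2).contDiffAt, Filter.Eventually.of_forall fun y => ?_⟩
  rw [InnerProductSpace.laplacian_eq_iteratedFDeriv_orthonormalBasis _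
    (EuclideanSpace.basisFun (Fin (p + p)) ℝ)]
  beta_reduce
  rw [Fin.sum_univ_add]
  simp only [iteratedFDeriv_two_comp_complexify hF, EuclideanSpace.basisFun_apply,
    complexify_single_natAdd, map_smul, smul_apply, smul_smul, Complex.I_mul_I]
  simp

theorem harmonicApproximable_of_equivLogTropical {p : ℕ} (hp : 0 < p) {w : ℝ≥0 → ℝ}
    (hw : EquivLogTropical w) : HarmonicApproximable (p + p) w := by
  obtain ⟨v, hv, c₁, c₂, hc₁, hc₂, hvw⟩ := hw
  obtain ⟨n, rfl⟩ := Nat.exists_eq_succ_of_ne_zero hp.ne'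
  obtain ⟨V, _, _, _, F, c, C, hc, hC, hFc, hF⟩ := exists_holomorphic_of_isLogTropicalWeight n hv
  let _ : NormedSpace ℝ V := NormedSpace.restrictScalars ℝ ℂ V
  have : FiniteDimensional ℝ V := FiniteDimensional.complexToReal V
  let e : V ≃L[ℝ] EuclideanSpace ℝ (Fin (Module.finrank ℝ V)) :=
    ContinuousLinearEquiv.ofFinrankEq (by simp)
  set A := ‖(e : V →L[ℝ] EuclideanSpace ℝ (Fin (Module.finrank ℝ V)))‖ + 1 with hA
  set B := ‖(e.symm : EuclideanSpace ℝ (Fin (Module.finrank ℝ V)) →L[ℝ] V)‖ + 1 with hB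
  have hA0 : 0 < A := by positivity
  have hB0 : 0 < B := by positivity
  have hAe : ∀ x, ‖e x‖ ≤ A * ‖x‖ := fun x =>
    ((e : V →L[ℝ] EuclideanSpace ℝ (Fin (Module.finrank ℝ V))).le_opNorm x).trans
      (by rw [hA]; gcongr; linarith)
  have hBe : ∀ x, ‖x‖ ≤ B * ‖e x‖ := fun x => by
    have := (e.symm : EuclideanSpace ℝ (Fin (Module.finrank ℝ V)) →L[ℝ] V).le_opNorm (e x)
    simp only [ContinuousLinearEquiv.coe_coe, ContinuousLinearEquiv.symm_apply_apply] at this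
    exact this.trans (by rw [hB]; gcongr; linarith)
  refine ⟨Module.finrank ℝ V, fun y => e (F (complexify (n + 1) y)), ?_, ?_,
    c₁ / (A * C), c₂ * B / c, by positivity, by positivity, fun y => ?_⟩
  -- the target is not trivial, since `F` does not vanish
  · have hF0 := (hF 0).1
    have : 0 < ‖F 0‖ := (mul_pos hc (hv.1.pos _)).trans_le hF0
    have : Nontrivial V := ⟨F 0, 0, norm_pos_iff.1 this⟩
    exact Module.finrank_pos
  · have := InnerProductSpace.HarmonicOnNhd.comp_CLM (harmonicOnNhd_comp_complexify hFc)
      (e : V →L[ℝ] EuclideanSpace ℝ (Fin (Module.finrank ℝ V)))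
    exact this
  · have h1 := hF (complexify (n + 1) y)
    rw [show ‖complexify (n + 1) y‖₊ = ‖y‖₊ from NNReal.eq (norm_complexify _ _)] at h1
    have h2 := hvw ‖y‖₊
    have h3 := hAe (F (complexify (n + 1) y))
    have h4 := hBe (F (complexify (n + 1) y))
    simp only [radialWeight]
    constructor
    · rw [div_mul_eq_mul_div, div_le_iff₀ (by positivity)]
      have : ‖e (F (complexify (n + 1) y))‖ ≤ A * (C * v ‖y‖₊) := h3.trans (by gcongr; exact h1.2)
      calc c₁ * ‖e (F (complexify (n + 1) y))‖ ≤ c₁ * (A * (C * v ‖y‖₊)) := by gcongr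
        _ = (c₁ * v ‖y‖₊) * (A * C) := by ring
        _ ≤ w ‖y‖₊ * (A * C) := by gcongr; exact h2.1
    · rw [div_mul_eq_mul_div, le_div_iff₀ hc]
      calc w ‖y‖₊ * c ≤ c₂ * v ‖y‖₊ * c := by gcongr; exact h2.2
        _ = c₂ * (c * v ‖y‖₊) := by ring
        _ ≤ c₂ * (B * ‖e (F (complexify (n + 1) y))‖) :=
          mul_le_mul_of_nonneg_left (h1.1.trans h4) hc₂.le
        _ = _ := by ring

end Complexification

/-! ### Power series from iterated radial Laplacians -/

section ScaleAvg

/-- The weighted dilation average `r ↦ ∫₀¹ bˢ G(b r) db`. -/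
noncomputable def scaleAvg (s : ℕ) (G : ℝ → ℝ) (r : ℝ) : ℝ :=
  ∫ b in (0 : ℝ)..1, b ^ s * G (b * r)

variable {s : ℕ} {G : ℝ → ℝ}

theorem continuous_scaleAvg (hG : Continuous G) : Continuous (scaleAvg s G) := by
  unfold scaleAvg
  exact intervalIntegral.continuous_parametric_intervalIntegral_of_continuous' (by fun_prop) 0 1

theorem scaleAvg_nonneg (hG : ∀ r, 0 ≤ r → 0 ≤ G r) {r : ℝ} (hr : 0 ≤ r) : 0 ≤ scaleAvg s G r :=
  intervalIntegral.integral_nonneg zero_le_one fun _ hb =>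
    mul_nonneg (pow_nonneg hb.1 s) (hG _ (mul_nonneg hb.1 hr))

/-- Dilation averages preserve the property that `G(r) / rⁿ` is non-decreasing. -/
theorem scaleAvg_mul_pow_le (hG : Continuous G) {n : ℕ}
    (h : ∀ r R, 0 < r → r ≤ R → G r * R ^ n ≤ G R * r ^ n) {r R : ℝ} (hr : 0 < r) (hrR : r ≤ R) :
    scaleAvg s G r * R ^ n ≤ scaleAvg s G R * r ^ n := by
  unfold scaleAvg
  rw [← intervalIntegral.integral_mul_const, ← intervalIntegral.integral_mul_const]
  refine intervalIntegral.integral_mono_on_of_le_Ioo zero_le_one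
    (Continuous.intervalIntegrable (by fun_prop) _ _)
    (Continuous.intervalIntegrable (by fun_prop) _ _) fun b hb => ?_
  have h1 := h (b * r) (b * R) (mul_pos hb.1 hr) (mul_le_mul_of_nonneg_left hrR hb.1.le)
  have hbn : 0 < b ^ n := pow_pos hb.1 n
  have h2 : G (b * r) * R ^ n ≤ G (b * R) * r ^ n := by
    rw [mul_pow, mul_pow] at h1
    refine le_of_mul_le_mul_left ?_ hbn
    linarith
  have := mul_le_mul_of_nonneg_left h2 (pow_nonneg hb.1.le s)
  linarith

theorem scaleAvg_sub_sum (hG : Continuous G) (n : ℕ) (c : ℕ → ℝ) (r : ℝ) :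
    scaleAvg s (fun x => G x - ∑ k ∈ Finset.range n, c k * x ^ (2 * k)) r =
      scaleAvg s G r - ∑ k ∈ Finset.range n, c k / (2 * k + s + 1) * r ^ (2 * k) := by
  have h1 : ∀ k : ℕ, ∫ b in (0 : ℝ)..1, c k * r ^ (2 * k) * b ^ (2 * k + s) =
      c k / (2 * k + s + 1) * r ^ (2 * k) := by
    intro k
    rw [intervalIntegral.integral_const_mul, integral_pow]
    push_cast
    simp
    ring
  have h2 : ∀ b : ℝ, b ^ s * (G (b * r) - ∑ k ∈ Finset.range n, c k * (b * r) ^ (2 * k)) =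
      b ^ s * G (b * r) - ∑ k ∈ Finset.range n, c k * r ^ (2 * k) * b ^ (2 * k + s) := by
    intro b
    rw [mul_sub, Finset.mul_sum]
    congr 1
    exact Finset.sum_congr rfl fun k _ => by ring
  unfold scaleAvg
  simp only [h2]
  rw [intervalIntegral.integral_sub (Continuous.intervalIntegrable (by fun_prop) _ _)
    (Continuous.intervalIntegrable (by fun_prop) _ _), intervalIntegral.integral_finsetSum
    (fun k _ => Continuous.intervalIntegrable (by fun_prop) _ _)]
  simp only [h1]

/-- The coefficients of Pizzetti's expansion of a radial function in dimension `s + 1`: the value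
at the origin of the `k`-th Laplacian is multiplied by `pizzettiCoeff s k`. -/
noncomputable def pizzettiCoeff (s : ℕ) : ℕ → ℝ
  | 0 => 1
  | k + 1 => pizzettiCoeff s k / (2 * k + s + 1) / (2 * k + (1 : ℕ) + 1)

theorem pizzettiCoeff_nonneg (s k : ℕ) : 0 ≤ pizzettiCoeff s k := by
  induction k with
  | zero => exact zero_le_one
  | succ k ih => rw [pizzettiCoeff]; positivity

/-- The remainders `Rₙ` of Pizzetti's expansion are non-negative, and `Rₙ(r) / r²ⁿ` is
non-decreasing: `Rₙ₊₁` is obtained from the `n`-th remainder of the shifted sequence by `r²` times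
two dilation averages, which preserve both properties up to the factor `r²`. -/
theorem pizzetti_remainder (n : ℕ) : ∀ {g : ℕ → ℝ → ℝ}, (∀ k, Continuous (g k)) →
    (∀ k r, 0 ≤ r → 0 ≤ g k r) → (∀ k, MonotoneOn (g k) (Set.Ici 0)) →
    (∀ k r, 0 ≤ r → g k r = g k 0 + r ^ 2 * scaleAvg 1 (scaleAvg s (g (k + 1))) r) →
    (∀ r, 0 ≤ r → 0 ≤ g 0 r - ∑ k ∈ Finset.range n, pizzettiCoeff s k * g k 0 * r ^ (2 * k)) ∧
    ∀ r R, 0 < r → r ≤ R →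
      (g 0 r - ∑ k ∈ Finset.range n, pizzettiCoeff s k * g k 0 * r ^ (2 * k)) * R ^ (2 * n) ≤
      (g 0 R - ∑ k ∈ Finset.range n, pizzettiCoeff s k * g k 0 * R ^ (2 * k)) * r ^ (2 * n) := by
  induction n with
  | zero =>
    intro g _ hnn hmono _
    refine ⟨fun r hr => by simpa using hnn 0 r hr, fun r R hr hrR => ?_⟩
    simpa using hmono 0 hr.le (hr.le.trans hrR) hrR
  | succ n ih =>
    intro g hc hnn hmono hrel
    obtain ⟨h1, h2⟩ := ih (g := fun k => g (k + 1)) (fun k => hc _) (fun k => hnn _)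
      (fun k => hmono _) (fun k => hrel _)
    set H : ℝ → ℝ := fun r =>
      g 1 r - ∑ k ∈ Finset.range n, pizzettiCoeff s k * g (k + 1) 0 * r ^ (2 * k) with hH
    have hHc : Continuous H := (hc 1).sub (by fun_prop)
    have key : ∀ r, 0 ≤ r →
        g 0 r - ∑ k ∈ Finset.range (n + 1), pizzettiCoeff s k * g k 0 * r ^ (2 * k) =
        r ^ 2 * scaleAvg 1 (scaleAvg s H) r := by
      intro r hr
      have e1 : scaleAvg s H = fun r => scaleAvg s (g 1) r -
          ∑ k ∈ Finset.range n, pizzettiCoeff s k * g (k + 1) 0 / (2 * k + s + 1) * r ^ (2 * k) :=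
        funext fun r => scaleAvg_sub_sum (hc 1) n _ r
      rw [e1, scaleAvg_sub_sum (continuous_scaleAvg (hc 1)), mul_sub, hrel 0 r hr,
        Finset.sum_range_succ', Finset.mul_sum, pizzettiCoeff]
      have e2 : ∀ k : ℕ, pizzettiCoeff s (k + 1) * g (k + 1) 0 * r ^ (2 * (k + 1)) =
          r ^ 2 * (pizzettiCoeff s k * g (k + 1) 0 / (2 * k + s + 1) / (2 * k + (1 : ℕ) + 1) *
            r ^ (2 * k)) := by
        intro k
        rw [pizzettiCoeff]
        ring
      simp only [e2]
      ring
    constructor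
    · intro r hr
      rw [key r hr]
      exact mul_nonneg (by positivity)
        (scaleAvg_nonneg (fun r hr => scaleAvg_nonneg h1 hr) hr)
    · intro r R hr hrR
      rw [key r hr.le, key R (hr.le.trans hrR)]
      have := scaleAvg_mul_pow_le (s := 1) (continuous_scaleAvg hHc)
        (fun r R hr hrR => scaleAvg_mul_pow_le (s := s) hHc h2 hr hrR) hr hrR
      calc r ^ 2 * scaleAvg 1 (scaleAvg s H) r * R ^ (2 * (n + 1))
          = r ^ 2 * R ^ 2 * (scaleAvg 1 (scaleAvg s H) r * R ^ (2 * n)) := by ring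
        _ ≤ r ^ 2 * R ^ 2 * (scaleAvg 1 (scaleAvg s H) R * r ^ (2 * n)) := by gcongr
        _ = _ := by ring

/-- Convergence of Pizzetti's expansion: comparing the remainders at `r` and `2 r` shows that the
`n`-th one is at most `4⁻ⁿ g₀(2r)`. -/
theorem hasSum_of_scaleAvg {g : ℕ → ℝ → ℝ} (hc : ∀ k, Continuous (g k))
    (hnn : ∀ k r, 0 ≤ r → 0 ≤ g k r) (hmono : ∀ k, MonotoneOn (g k) (Set.Ici 0))
    (hrel : ∀ k r, 0 ≤ r → g k r = g k 0 + r ^ 2 * scaleAvg 1 (scaleAvg s (g (k + 1))) r)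
    {r : ℝ} (hr : 0 < r) :
    HasSum (fun k => pizzettiCoeff s k * g k 0 * r ^ (2 * k)) (g 0 r) := by
  have hterm : ∀ R : ℝ, ∀ k, 0 ≤ pizzettiCoeff s k * g k 0 * R ^ (2 * k) := fun R k =>
    mul_nonneg (mul_nonneg (pizzettiCoeff_nonneg s k) (hnn k 0 le_rfl))
      ((even_two_mul k).pow_nonneg R)
  rw [hasSum_iff_tendsto_nat_of_nonneg (hterm r)]
  have hlim : Filter.Tendsto (fun n : ℕ => g 0 (2 * r) * (1 / 4 : ℝ) ^ n)
      Filter.atTop (nhds 0) := by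
    simpa using (tendsto_pow_atTop_nhds_zero_of_lt_one (show (0 : ℝ) ≤ 1 / 4 by norm_num)
      (by norm_num)).const_mul (g 0 (2 * r))
  have hrem : Filter.Tendsto (fun n : ℕ =>
      g 0 r - ∑ k ∈ Finset.range n, pizzettiCoeff s k * g k 0 * r ^ (2 * k))
      Filter.atTop (nhds 0) := by
    refine squeeze_zero (fun n => (pizzetti_remainder n hc hnn hmono hrel).1 r hr.le)
      (fun n => ?_) hlim
    have h1 := (pizzetti_remainder n hc hnn hmono hrel).2 r (2 * r) hr (by linarith)
    have h2 := Finset.sum_nonneg fun k (_ : k ∈ Finset.range n) => hterm (2 * r) k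
    have h3 : (g 0 (2 * r) - ∑ k ∈ Finset.range n, pizzettiCoeff s k * g k 0 * (2 * r) ^ (2 * k)) *
        r ^ (2 * n) ≤ g 0 (2 * r) * r ^ (2 * n) := by gcongr; linarith
    have h4 := h1.trans h3
    rw [mul_pow, pow_mul 2 2 n] at h4
    rw [one_div, inv_pow, ← div_eq_mul_inv, le_div_iff₀ (by positivity)]
    norm_num at h4
    refine le_of_mul_le_mul_right ?_ (show 0 < r ^ (2 * n) by positivity)
    linarith
  simpa using hrem.const_sub (g 0 r)

variable {g g' g'' : ℝ → ℝ}

/-- The radial equation `g'' + (s / r) g' = G` in integrated form: `(rˢ g')' = rˢ G`. -/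
theorem deriv_eq_scaleAvg (hs : 1 ≤ s) (hg' : ∀ r, HasDerivAt g' (g'' r) r) (hG : Continuous G)
    (hode : ∀ r, 0 < r → r * G r = r * g'' r + s * g' r) {r : ℝ} (hr : 0 < r) :
    g' r = r * scaleAvg s G r := by
  have hc' : Continuous g' := continuous_iff_continuousAt.2 fun r => (hg' r).continuousAt
  have hd : ∀ b ∈ Set.Ioo (0 : ℝ) 1,
      HasDerivAt (fun b => b ^ s * g' (b * r)) (r * (b ^ s * G (b * r))) b := by
    intro b hb
    have h1 : HasDerivAt (fun b => g' (b * r)) (g'' (b * r) * r) b := by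
      simpa [Function.comp_def] using (hg' (b * r)).comp b ((hasDerivAt_id b).mul_const r)
    refine ((hasDerivAt_pow s b).mul h1).congr_deriv ?_
    have h2 := hode (b * r) (mul_pos hb.1 hr)
    obtain ⟨t, rfl⟩ := Nat.exists_eq_add_of_le' hs
    rw [Nat.add_sub_cancel, pow_succ]
    linear_combination (-(b ^ t)) * h2
  have := intervalIntegral.integral_eq_sub_of_hasDerivAt_of_le zero_le_one
    (Continuous.continuousOn (by fun_prop)) hd (Continuous.intervalIntegrable (by fun_prop) _ _)
  rw [intervalIntegral.integral_const_mul] at this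
  simp only [one_pow, one_mul, zero_pow (Nat.one_le_iff_ne_zero.1 hs), zero_mul, sub_zero] at this
  exact this.symm

theorem eq_add_scaleAvg (hs : 1 ≤ s) (hg : ∀ r, HasDerivAt g (g' r) r)
    (hg' : ∀ r, HasDerivAt g' (g'' r) r) (hG : Continuous G)
    (hode : ∀ r, 0 < r → r * G r = r * g'' r + s * g' r) {r : ℝ} (hr : 0 ≤ r) :
    g r = g 0 + r ^ 2 * scaleAvg 1 (scaleAvg s G) r := by
  rcases hr.eq_or_lt with rfl | hr
  · simp
  have hc : Continuous g := continuous_iff_continuousAt.2 fun r => (hg r).continuousAt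
  have hsc := continuous_scaleAvg (s := s) hG
  have hd : ∀ b ∈ Set.Ioo (0 : ℝ) 1,
      HasDerivAt (fun b => g (b * r)) (r ^ 2 * (b ^ 1 * scaleAvg s G (b * r))) b := by
    intro b hb
    have h1 : HasDerivAt (fun b => g (b * r)) (g' (b * r) * r) b := by
      simpa [Function.comp_def] using (hg (b * r)).comp b ((hasDerivAt_id b).mul_const r)
    refine h1.congr_deriv ?_
    rw [deriv_eq_scaleAvg hs hg' hG hode (mul_pos hb.1 hr)]
    ring
  have := intervalIntegral.integral_eq_sub_of_hasDerivAt_of_le zero_le_one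
    (Continuous.continuousOn (by fun_prop)) hd (Continuous.intervalIntegrable (by fun_prop) _ _)
  rw [intervalIntegral.integral_const_mul] at this
  simp only [one_mul, zero_mul] at this
  unfold scaleAvg at this ⊢
  linarith

theorem monotoneOn_of_radial_ode (hs : 1 ≤ s) (hg : ∀ r, HasDerivAt g (g' r) r)
    (hg' : ∀ r, HasDerivAt g' (g'' r) r) (hG : Continuous G) (hG0 : ∀ r, 0 ≤ r → 0 ≤ G r)
    (hode : ∀ r, 0 < r → r * G r = r * g'' r + s * g' r) : MonotoneOn g (Set.Ici 0) := by
  refine monotoneOn_of_hasDerivWithinAt_nonneg (convex_Ici 0)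
    (fun r _ => (hg r).continuousAt.continuousWithinAt)
    (fun r _ => (hg r).hasDerivWithinAt) fun r hr => ?_
  rw [interior_Ici] at hr
  rw [deriv_eq_scaleAvg hs hg' hG hode hr]
  exact mul_nonneg (le_of_lt hr) (scaleAvg_nonneg hG0 (le_of_lt hr))

end ScaleAvg

/-! ### Averages over the orthogonal group -/

section RotationAverage

open MeasureTheory

theorem hasDerivAt_integral_of_compactSpace {K : Type*} [TopologicalSpace K] [CompactSpace K]
    [MeasurableSpace K] [BorelSpace K] (μ : Measure K) [IsFiniteMeasure μ] {f f' : K → ℝ → ℝ}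
    (hf : Continuous fun p : K × ℝ => f p.1 p.2) (hf' : Continuous fun p : K × ℝ => f' p.1 p.2)
    (hd : ∀ k t, HasDerivAt (f k) (f' k t) t) (t : ℝ) :
    HasDerivAt (fun t => ∫ k, f k t ∂μ) (∫ k, f' k t ∂μ) t := by
  have hfc : ∀ t, Continuous fun k => f k t := fun t =>
    hf.comp (by fun_prop : Continuous fun k => (k, t))
  have hfc' : ∀ t, Continuous fun k => f' k t := fun t =>
    hf'.comp (by fun_prop : Continuous fun k => (k, t))
  obtain ⟨C, hC⟩ := ((isCompact_univ (X := K)).prod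
    (isCompact_closedBall t 1)).exists_bound_of_continuousOn hf'.continuousOn
  refine (hasDerivAt_integral_of_dominated_loc_of_deriv_le (bound := fun _ => C)
    (Metric.closedBall_mem_nhds t one_pos)
    (Filter.Eventually.of_forall fun t => (hfc t).aestronglyMeasurable)
    ((hfc t).integrable_of_hasCompactSupport (HasCompactSupport.of_compactSpace _))
    (hfc' t).aestronglyMeasurable
    (Filter.Eventually.of_forall fun k s hs => hC (k, s) ⟨Set.mem_univ _, hs⟩)
    (integrable_const C) (Filter.Eventually.of_forall fun k s _ => hd k s)).2

variable {E : Type*} [NormedAddCommGroup E] [InnerProductSpace ℝ E] [FiniteDimensional ℝ E]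

instance compactSpace_unitary : CompactSpace (unitary (E →L[ℝ] E)) := by
  refine isCompact_iff_compactSpace.1 (Metric.isCompact_of_isClosed_isBounded isClosed_unitary ?_)
  refine (Metric.isBounded_closedBall (x := (0 : E →L[ℝ] E)) (r := 1)).subset fun u hu => ?_
  rw [mem_closedBall_zero_iff]
  exact u.opNorm_le_bound zero_le_one fun x => by
    rw [one_mul]; exact (Unitary.norm_map ⟨u, hu⟩ x).le

theorem continuous_unitary_inv_apply {T : Type*} [TopologicalSpace T]
    {f : T → unitary (E →L[ℝ] E)} {γ : T → E} (hf : Continuous f) (hγ : Continuous γ) :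
    Continuous fun t => ((f t)⁻¹ : unitary (E →L[ℝ] E)).1 (γ t) :=
  (continuous_subtype_val.comp hf.inv).clm_apply hγ

/-- The average of `u` over the orbit of `y` under the orthogonal group, with respect to the (not
normalized) Haar measure. The inverse turns left invariance of the measure into
invariance in `y`. -/
noncomputable def rotAvg (u : E → ℝ) (y : E) : ℝ :=
  ∫ k : unitary (E →L[ℝ] E), u ((k⁻¹ : unitary (E →L[ℝ] E)).1 y) ∂Measure.haar

theorem continuous_rotAvg {u : E → ℝ} (hu : Continuous u) : Continuous (rotAvg u) := by
  have := continuous_parametric_integral_of_continuous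
    (μ := (Measure.haar : Measure (unitary (E →L[ℝ] E))))
    (f := fun (y : E) (k : unitary (E →L[ℝ] E)) => u ((k⁻¹ : unitary (E →L[ℝ] E)).1 y))
    (hu.comp (continuous_unitary_inv_apply continuous_snd continuous_fst)) isCompact_univ
  unfold rotAvg
  simpa only [setIntegral_univ] using this

theorem integrable_rotAvg {u : E → ℝ} (hu : Continuous u) (y : E) :
    Integrable (fun k : unitary (E →L[ℝ] E) => u ((k⁻¹ : unitary (E →L[ℝ] E)).1 y))
      Measure.haar :=
  (hu.comp (continuous_unitary_inv_apply continuous_id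
    continuous_const)).integrable_of_hasCompactSupport (HasCompactSupport.of_compactSpace _)

theorem norm_unitary_inv_apply (k : unitary (E →L[ℝ] E)) (y : E) :
    ‖(k⁻¹ : unitary (E →L[ℝ] E)).1 y‖ = ‖y‖ := Unitary.norm_map _ _

/-- Rotation averages are radial: two vectors of equal norm are exchanged by a reflection, and the
Haar measure is invariant. -/
theorem rotAvg_congr_norm (u : E → ℝ) {y z : E} (h : ‖y‖ = ‖z‖) : rotAvg u y = rotAvg u z := by
  set g : unitary (E →L[ℝ] E) :=
    Unitary.linearIsometryEquiv.symm (Submodule.reflection (Submodule.span ℝ {y - z})ᗮ) with hg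
  have hgy : g.1 y = z := Submodule.reflection_sub h
  unfold rotAvg
  symm
  rw [← integral_mul_left_eq_self _ g]
  congr 1
  ext k
  rw [← hgy]
  have : ((g * k)⁻¹ * g).1 y = (k⁻¹ : unitary (E →L[ℝ] E)).1 y := by
    rw [mul_inv_rev, inv_mul_cancel_right]
  exact congrArg u this

/-- The average of the first derivative of `u` at `k⁻¹ y` in the direction `k⁻¹ v`. -/
noncomputable def rotAvgDeriv (u : E → ℝ) (y v : E) : ℝ :=
  ∫ k : unitary (E →L[ℝ] E), fderiv ℝ u ((k⁻¹ : unitary (E →L[ℝ] E)).1 y)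
    ((k⁻¹ : unitary (E →L[ℝ] E)).1 v) ∂Measure.haar

/-- The average of the second derivative of `u` at `k⁻¹ y` in the direction `k⁻¹ v`. -/
noncomputable def rotAvgDeriv₂ (u : E → ℝ) (y v : E) : ℝ :=
  ∫ k : unitary (E →L[ℝ] E), fderiv ℝ (fderiv ℝ u) ((k⁻¹ : unitary (E →L[ℝ] E)).1 y)
    ((k⁻¹ : unitary (E →L[ℝ] E)).1 v) ((k⁻¹ : unitary (E →L[ℝ] E)).1 v) ∂Measure.haar

theorem rotAvgDeriv_smul (u : E → ℝ) (y v : E) (c : ℝ) :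
    rotAvgDeriv u y (c • v) = c * rotAvgDeriv u y v := by
  simp only [rotAvgDeriv, map_smul, smul_eq_mul, integral_const_mul]

theorem rotAvgDeriv₂_smul (u : E → ℝ) (y v : E) (c : ℝ) :
    rotAvgDeriv₂ u y (c • v) = c ^ 2 * rotAvgDeriv₂ u y v := by
  simp only [rotAvgDeriv₂, map_smul, smul_apply, smul_eq_mul, ← mul_assoc, ← sq,
    integral_const_mul]

variable {u : E → ℝ} {γ γ' γ'' : ℝ → E}

theorem hasDerivAt_rotAvg (hu : ContDiff ℝ 1 u) (hγ : ∀ t, HasDerivAt γ (γ' t) t)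
    (hγ' : Continuous γ') (t : ℝ) :
    HasDerivAt (fun t => rotAvg u (γ t)) (rotAvgDeriv u (γ t) (γ' t)) t := by
  have hγc : Continuous γ := continuous_iff_continuousAt.2 fun t => (hγ t).continuousAt
  have h1 : Continuous (fderiv ℝ u) := hu.continuous_fderiv (by simp)
  refine hasDerivAt_integral_of_compactSpace _
    (f := fun k t => u ((k⁻¹ : unitary (E →L[ℝ] E)).1 (γ t)))
    (f' := fun k t => fderiv ℝ u ((k⁻¹ : unitary (E →L[ℝ] E)).1 (γ t))
    ((k⁻¹ : unitary (E →L[ℝ] E)).1 (γ' t))) ?_ ?_ (fun k t => ?_) t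
  · exact hu.continuous.comp (continuous_unitary_inv_apply continuous_fst (hγc.comp continuous_snd))
  · exact (h1.comp (continuous_unitary_inv_apply continuous_fst
      (hγc.comp continuous_snd))).clm_apply
      (continuous_unitary_inv_apply continuous_fst (hγ'.comp continuous_snd))
  · have h2 := ((k⁻¹ : unitary (E →L[ℝ] E)).1.hasFDerivAt (x := γ t)).comp_hasDerivAt t (hγ t)
    exact ((hu.differentiable (by simp) _).hasFDerivAt).comp_hasDerivAt t h2

theorem hasDerivAt_rotAvgDeriv (hu : ContDiff ℝ 2 u) (hγ : ∀ t, HasDerivAt γ (γ' t) t)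
    (hγ' : ∀ t, HasDerivAt γ' (γ'' t) t) (hγ'' : Continuous γ'') (t : ℝ) :
    HasDerivAt (fun t => rotAvgDeriv u (γ t) (γ' t))
      (rotAvgDeriv₂ u (γ t) (γ' t) + rotAvgDeriv u (γ t) (γ'' t)) t := by
  have hγc : Continuous γ := continuous_iff_continuousAt.2 fun t => (hγ t).continuousAt
  have hγc' : Continuous γ' := continuous_iff_continuousAt.2 fun t => (hγ' t).continuousAt
  have hu1 : ContDiff ℝ 1 (fderiv ℝ u) := hu.fderiv_right (by norm_num)
  have h2 : Continuous (fderiv ℝ (fderiv ℝ u)) := hu1.continuous_fderiv (by simp)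
  have hc : ∀ {δ : ℝ → E}, Continuous δ → Continuous fun p : unitary (E →L[ℝ] E) × ℝ =>
      (p.1⁻¹ : unitary (E →L[ℝ] E)).1 (δ p.2) := fun hδ =>
    continuous_unitary_inv_apply continuous_fst (hδ.comp continuous_snd)
  have hA : Continuous fun p : unitary (E →L[ℝ] E) × ℝ =>
      fderiv ℝ (fderiv ℝ u) ((p.1⁻¹ : unitary (E →L[ℝ] E)).1 (γ p.2))
        ((p.1⁻¹ : unitary (E →L[ℝ] E)).1 (γ' p.2)) ((p.1⁻¹ : unitary (E →L[ℝ] E)).1 (γ' p.2)) :=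
    ((h2.comp (hc hγc)).clm_apply (hc hγc')).clm_apply (hc hγc')
  have hB : Continuous fun p : unitary (E →L[ℝ] E) × ℝ =>
      fderiv ℝ u ((p.1⁻¹ : unitary (E →L[ℝ] E)).1 (γ p.2))
        ((p.1⁻¹ : unitary (E →L[ℝ] E)).1 (γ'' p.2)) :=
    (hu1.continuous.comp (hc hγc)).clm_apply (hc hγ'')
  have key := hasDerivAt_integral_of_compactSpace (Measure.haar : Measure (unitary (E →L[ℝ] E)))
    (f := fun k t => fderiv ℝ u ((k⁻¹ : unitary (E →L[ℝ] E)).1 (γ t))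
      ((k⁻¹ : unitary (E →L[ℝ] E)).1 (γ' t)))
    (f' := fun k t => fderiv ℝ (fderiv ℝ u) ((k⁻¹ : unitary (E →L[ℝ] E)).1 (γ t))
        ((k⁻¹ : unitary (E →L[ℝ] E)).1 (γ' t)) ((k⁻¹ : unitary (E →L[ℝ] E)).1 (γ' t)) +
      fderiv ℝ u ((k⁻¹ : unitary (E →L[ℝ] E)).1 (γ t)) ((k⁻¹ : unitary (E →L[ℝ] E)).1 (γ'' t)))
    ((hu1.continuous.comp (hc hγc)).clm_apply (hc hγc')) (hA.add hB) (fun k t => ?_) t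
  · refine key.congr_deriv (integral_add ?_ ?_)
    · exact (hA.comp (by fun_prop : Continuous fun k => (k, t))).integrable_of_hasCompactSupport
        (HasCompactSupport.of_compactSpace _)
    · exact (hB.comp (by fun_prop : Continuous fun k => (k, t))).integrable_of_hasCompactSupport
        (HasCompactSupport.of_compactSpace _)
  · have e1 := ((k⁻¹ : unitary (E →L[ℝ] E)).1.hasFDerivAt (x := γ t)).comp_hasDerivAt t (hγ t)
    have e2 := ((k⁻¹ : unitary (E →L[ℝ] E)).1.hasFDerivAt (x := γ' t)).comp_hasDerivAt t (hγ' t)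
    have e3 := ((hu1.differentiable (by simp) _).hasFDerivAt).comp_hasDerivAt t e1
    exact e3.clm_apply e2

/-- Second derivative at `θ = 0` of the constant function `θ ↦ rotAvg u (r cos θ e + r sin θ f)`. -/
theorem rotAvgDeriv₂_orthogonal (hu : ContDiff ℝ 2 u) {e f : E} (he : ‖e‖ = 1) (hf : ‖f‖ = 1)
    (hef : inner ℝ e f = 0) (r : ℝ) :
    r ^ 2 * rotAvgDeriv₂ u (r • e) f = r * rotAvgDeriv u (r • e) e := by
  set γ : ℝ → E := fun θ => (r * Real.cos θ) • e + (r * Real.sin θ) • f with hγd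
  set γ' : ℝ → E := fun θ => (-(r * Real.sin θ)) • e + (r * Real.cos θ) • f with hγd'
  set γ'' : ℝ → E := fun θ => (-(r * Real.cos θ)) • e + (-(r * Real.sin θ)) • f with hγd''
  have hs : ∀ θ, HasDerivAt (fun θ => r * Real.sin θ) (r * Real.cos θ) θ := fun θ =>
    (Real.hasDerivAt_sin θ).const_mul r
  have hc : ∀ θ, HasDerivAt (fun θ => r * Real.cos θ) (-(r * Real.sin θ)) θ := fun θ => by
    simpa using (Real.hasDerivAt_cos θ).const_mul r
  have h1 : ∀ θ, HasDerivAt γ (γ' θ) θ := fun θ =>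
    ((hc θ).smul_const e).add ((hs θ).smul_const f)
  have h2 : ∀ θ, HasDerivAt γ' (γ'' θ) θ := fun θ =>
    ((hs θ).neg.smul_const e).add ((hc θ).smul_const f)
  have hnorm : ∀ θ, ‖γ θ‖ = ‖γ 0‖ := by
    have : ∀ θ, ‖γ θ‖ ^ 2 = r ^ 2 := by
      intro θ
      rw [hγd, norm_add_sq_real, real_inner_smul_left, real_inner_smul_right, hef, norm_smul,
        norm_smul, he, hf, Real.norm_eq_abs, Real.norm_eq_abs, mul_one, mul_one, sq_abs, sq_abs]
      nlinarith [Real.sin_sq_add_cos_sq θ]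
    intro θ
    exact (pow_left_inj₀ (norm_nonneg _) (norm_nonneg _) two_ne_zero).1
      ((this θ).trans (this 0).symm)
  have h3 : ∀ θ, rotAvgDeriv u (γ θ) (γ' θ) = 0 := by
    intro θ
    have := hasDerivAt_rotAvg (hu.of_le (by norm_num)) h1 (by fun_prop) θ
    rw [show (fun t => rotAvg u (γ t)) = fun _ => rotAvg u (γ 0) from
      funext fun t => rotAvg_congr_norm u (hnorm t)] at this
    exact this.unique (hasDerivAt_const _ _)
  have h4 := hasDerivAt_rotAvgDeriv hu h1 h2 (by fun_prop) 0
  simp only [h3] at h4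
  have h5 := h4.unique (hasDerivAt_const _ _)
  have e0 : γ 0 = r • e := by simp [hγd]
  have e1 : γ' 0 = r • f := by simp [hγd']
  have e2 : γ'' 0 = (-r) • e := by simp [hγd'']
  rw [e0, e1, e2, rotAvgDeriv₂_smul, rotAvgDeriv_smul] at h5
  linarith

theorem rotAvg_laplacian (hu : ContDiff ℝ 2 u) {ι : Type*} [Fintype ι]
    (v : OrthonormalBasis ι ℝ E) (y : E) :
    rotAvg (Laplacian.laplacian u) y = ∑ i, rotAvgDeriv₂ u y (v i) := by
  have hu1 : ContDiff ℝ 1 (fderiv ℝ u) := hu.fderiv_right (by norm_num)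
  have h2 : Continuous (fderiv ℝ (fderiv ℝ u)) := hu1.continuous_fderiv (by simp)
  unfold rotAvg rotAvgDeriv₂
  rw [← integral_finsetSum]
  · congr 1
    ext k
    rw [InnerProductSpace.laplacian_eq_iteratedFDeriv_orthonormalBasis u
      (v.map (Unitary.linearIsometryEquiv k⁻¹))]
    simp only [iteratedFDeriv_two_apply]
    rfl
  · intro i _
    refine Continuous.integrable_of_hasCompactSupport ?_ (HasCompactSupport.of_compactSpace _)
    have hc : ∀ w : E, Continuous fun k : unitary (E →L[ℝ] E) =>
        (k⁻¹ : unitary (E →L[ℝ] E)).1 w := fun w =>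
      continuous_unitary_inv_apply continuous_id continuous_const
    exact ((h2.comp (hc y)).clm_apply (hc _)).clm_apply (hc _)

/-- The averages of `u` and of its Laplacian along a ray are related by the radial form of the
Laplacian in dimension `s + 1`. -/
theorem rotAvg_radial_ode (hu : ContDiff ℝ 2 u) {s : ℕ} (v : OrthonormalBasis (Fin (s + 1)) ℝ E)
    {r : ℝ} (hr : 0 < r) :
    r * rotAvg (Laplacian.laplacian u) (r • v 0) =
      r * rotAvgDeriv₂ u (r • v 0) (v 0) + s * rotAvgDeriv u (r • v 0) (v 0) := by
  have h1 : ∀ i : Fin s, r ^ 2 * rotAvgDeriv₂ u (r • v 0) (v i.succ) =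
      r * rotAvgDeriv u (r • v 0) (v 0) := fun i =>
    rotAvgDeriv₂_orthogonal hu (v.orthonormal.1 _) (v.orthonormal.1 _)
      (v.orthonormal.2 (Fin.succ_ne_zero i).symm) r
  refine mul_left_cancel₀ hr.ne' ?_
  rw [rotAvg_laplacian hu v, Fin.sum_univ_succ]
  calc r * (r * (rotAvgDeriv₂ u (r • v 0) (v 0) + ∑ i : Fin s, rotAvgDeriv₂ u (r • v 0) (v i.succ)))
      = r * (r * rotAvgDeriv₂ u (r • v 0) (v 0)) +
          ∑ i : Fin s, r ^ 2 * rotAvgDeriv₂ u (r • v 0) (v i.succ) := by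
        rw [← Finset.mul_sum]; ring
    _ = _ := by
        rw [Finset.sum_congr rfl fun i _ => h1 i]
        simp
        ring

theorem hasDerivAt_rotAvg_ray (hu : ContDiff ℝ 1 u) (e : E) (r : ℝ) :
    HasDerivAt (fun r : ℝ => rotAvg u (r • e)) (rotAvgDeriv u (r • e) e) r :=
  hasDerivAt_rotAvg hu (γ := fun r : ℝ => r • e) (γ' := fun _ => e)
    (fun t => by simpa using (hasDerivAt_id t).smul_const e) continuous_const r

theorem hasDerivAt_rotAvgDeriv_ray (hu : ContDiff ℝ 2 u) (e : E) (r : ℝ) :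
    HasDerivAt (fun r : ℝ => rotAvgDeriv u (r • e) e) (rotAvgDeriv₂ u (r • e) e) r := by
  have := hasDerivAt_rotAvgDeriv hu (γ := fun r : ℝ => r • e) (γ' := fun _ => e)
    (γ'' := fun _ => 0)
    (fun t => by simpa using (hasDerivAt_id t).smul_const e) (fun t => hasDerivAt_const t e)
    continuous_const r
  simpa [rotAvgDeriv] using this

theorem continuous_laplacian (hu : ContDiff ℝ 2 u) : Continuous (Laplacian.laplacian u) := by
  rw [InnerProductSpace.laplacian_eq_iteratedFDeriv_stdOrthonormalBasis]
  refine continuous_finsetSum _ fun i _ => ?_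
  have hu1 : ContDiff ℝ 1 (fderiv ℝ u) := hu.fderiv_right (by norm_num)
  have h2 : Continuous (fderiv ℝ (fderiv ℝ u)) := hu1.continuous_fderiv (by simp)
  simp only [iteratedFDeriv_two_apply]
  fun_prop

theorem rotAvg_eq_add_scaleAvg (hu : ContDiff ℝ 2 u) {s : ℕ} (hs : 1 ≤ s)
    (v : OrthonormalBasis (Fin (s + 1)) ℝ E) {r : ℝ} (hr : 0 ≤ r) :
    rotAvg u (r • v 0) = rotAvg u ((0 : ℝ) • v 0) +
      r ^ 2 * scaleAvg 1 (scaleAvg s fun t => rotAvg (Laplacian.laplacian u) (t • v 0)) r :=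
  eq_add_scaleAvg (g := fun r => rotAvg u (r • v 0)) hs
    (hasDerivAt_rotAvg_ray (hu.of_le (by norm_num)) (v 0)) (hasDerivAt_rotAvgDeriv_ray hu (v 0))
    ((continuous_rotAvg (continuous_laplacian hu)).comp (by fun_prop))
    (fun _ hr => rotAvg_radial_ode hu v hr) hr

theorem monotoneOn_rotAvg (hu : ContDiff ℝ 2 u) (hΔ : ∀ y, 0 ≤ Laplacian.laplacian u y)
    {s : ℕ} (hs : 1 ≤ s) (v : OrthonormalBasis (Fin (s + 1)) ℝ E) :
    MonotoneOn (fun r : ℝ => rotAvg u (r • v 0)) (Set.Ici 0) :=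
  monotoneOn_of_radial_ode hs
    (hasDerivAt_rotAvg_ray (hu.of_le (by norm_num)) (v 0)) (hasDerivAt_rotAvgDeriv_ray hu (v 0))
    ((continuous_rotAvg (continuous_laplacian hu)).comp (by fun_prop))
    (fun _ _ => integral_nonneg fun _ => hΔ _)
    (fun _ hr => rotAvg_radial_ode hu v hr)

variable (E) in
/-- The total mass of the Haar measure on the orthogonal group of `E`. -/
noncomputable def rotMass : ℝ := (Measure.haar : Measure (unitary (E →L[ℝ] E))).real Set.univ

variable (E) in
theorem rotMass_pos : 0 < rotMass E :=
  ENNReal.toReal_pos (IsOpen.measure_pos _ isOpen_univ Set.univ_nonempty).ne' (measure_ne_top _ _)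

theorem rotAvg_zero (u : E → ℝ) : rotAvg u 0 = rotMass E * u 0 := by
  simp [rotAvg, rotMass]

theorem rotMass_mul_le_rotAvg (hu : Continuous u) {y : E} {A : ℝ}
    (h : ∀ z, ‖z‖ = ‖y‖ → A ≤ u z) : rotMass E * A ≤ rotAvg u y := by
  have := integral_mono (integrable_const A) (integrable_rotAvg hu y)
    fun k => h _ (norm_unitary_inv_apply k y)
  rwa [integral_const, smul_eq_mul] at this

theorem rotAvg_le_rotMass_mul (hu : Continuous u) {y : E} {B : ℝ}
    (h : ∀ z, ‖z‖ = ‖y‖ → u z ≤ B) : rotAvg u y ≤ rotMass E * B := by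
  have := integral_mono (integrable_rotAvg hu y) (integrable_const B)
    fun k => h _ (norm_unitary_inv_apply k y)
  rwa [integral_const, smul_eq_mul] at this

/-- The mean value property. -/
theorem rotAvg_of_laplacian_eq_zero (hu : ContDiff ℝ 2 u) (hΔ : Laplacian.laplacian u = 0)
    {s : ℕ} (hs : 1 ≤ s) (v : OrthonormalBasis (Fin (s + 1)) ℝ E) (y : E) :
    rotAvg u y = rotMass E * u 0 := by
  have h1 : ‖y‖ = ‖(‖y‖ • v 0 : E)‖ := by
    rw [norm_smul, v.orthonormal.1, mul_one, norm_norm]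
  have h2 : rotAvg (0 : E → ℝ) = 0 := by ext; simp [rotAvg]
  rw [rotAvg_congr_norm u h1, rotAvg_eq_add_scaleAvg hu hs v (norm_nonneg y), zero_smul,
    rotAvg_zero, hΔ, h2]
  simp [scaleAvg]

end RotationAverage

/-! ### Harmonic functions are smooth -/

section Regularity

open MeasureTheory

variable {E : Type*} [NormedAddCommGroup E]

/-- A smooth bump function supported in the unit ball that depends only on the norm. -/
noncomputable def radialBump (t : E) : ℝ := Real.smoothTransition (1 - ‖t‖ ^ 2)

theorem radialBump_of_one_le {t : E} (ht : 1 ≤ ‖t‖) : radialBump t = 0 :=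
  Real.smoothTransition.zero_of_nonpos (by nlinarith)

variable [InnerProductSpace ℝ E]

theorem contDiff_radialBump : ContDiff ℝ ∞ (radialBump : E → ℝ) :=
  Real.smoothTransition.contDiff.comp (contDiff_const.sub (contDiff_norm_sq ℝ))

variable [FiniteDimensional ℝ E]

theorem hasCompactSupport_radialBump : HasCompactSupport (radialBump : E → ℝ) :=
  HasCompactSupport.intro (isCompact_closedBall 0 1) fun t ht =>
    radialBump_of_one_le (by rw [mem_closedBall_zero_iff] at ht; linarith)

theorem laplacian_comp_add_left (f : E → ℝ) (x : E) :
    Laplacian.laplacian (fun y => f (x + y)) = fun y => Laplacian.laplacian f (x + y) := by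
  simp only [InnerProductSpace.laplacian_eq_iteratedFDeriv_stdOrthonormalBasis,
    iteratedFDeriv_comp_add_left]

variable [MeasurableSpace E] [BorelSpace E]

theorem integral_radialBump_pos : 0 < ∫ t : E, radialBump t := by
  refine contDiff_radialBump.continuous.integral_pos_of_hasCompactSupport_nonneg_nonzero
    hasCompactSupport_radialBump (fun t => Real.smoothTransition.nonneg _) (x := 0) ?_
  simp [radialBump, Real.smoothTransition.one]

theorem integral_radialBump_mul_comp_unitary (g : E → ℝ) (k : unitary (E →L[ℝ] E)) :
    ∫ t, radialBump t * g ((k⁻¹ : unitary (E →L[ℝ] E)).1 t) = ∫ t, radialBump t * g t := by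
  set f := Unitary.linearIsometryEquiv (k⁻¹) with hf
  have h1 := f.measurePreserving.integral_comp f.toHomeomorph.measurableEmbedding
    (fun t => radialBump t * g t)
  rw [← h1]
  congr 1
  ext t
  rw [radialBump, radialBump, f.norm_map]
  rfl

/-- Averaging over rotations the convolution of `h` with a radial bump and using the mean value
property shows that the convolution is a multiple of `h`. -/
theorem contDiff_of_harmonic {s : ℕ} (hs : 1 ≤ s) (v : OrthonormalBasis (Fin (s + 1)) ℝ E)
    {h : E → ℝ} (hh : ContDiff ℝ 2 h) (hΔ : Laplacian.laplacian h = 0) : ContDiff ℝ ∞ h := by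
  set c := rotMass E with hc
  have hc0 : 0 < c := rotMass_pos E
  set m := ∫ t : E, radialBump t with hm
  have hm0 : 0 < m := integral_radialBump_pos
  have hmean : ∀ x t, ∫ k : unitary (E →L[ℝ] E), h (x - (k⁻¹ : unitary (E →L[ℝ] E)).1 t)
      ∂Measure.haar = c * h x := by
    intro x t
    have h1 := rotAvg_of_laplacian_eq_zero (u := fun y => h (x + y)) (by fun_prop)
      (by rw [laplacian_comp_add_left, hΔ]; rfl) hs v (-t)
    simpa only [rotAvg, map_neg, ← sub_eq_add_neg, add_zero] using h1
  have key : ∀ x, convolution (radialBump : E → ℝ) h (ContinuousLinearMap.lsmul ℝ ℝ) volume x =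
      m * h x := by
    intro x
    set I := ∫ t, radialBump t * h (x - t) with hI
    have h1 : ∀ k : unitary (E →L[ℝ] E),
        ∫ t, radialBump t * h (x - (k⁻¹ : unitary (E →L[ℝ] E)).1 t) = I := fun k =>
      integral_radialBump_mul_comp_unitary (fun t => h (x - t)) k
    have hcont : Continuous fun p : unitary (E →L[ℝ] E) × E =>
        radialBump p.2 * h (x - (p.1⁻¹ : unitary (E →L[ℝ] E)).1 p.2) :=
      (contDiff_radialBump.continuous.comp continuous_snd).mul (hh.continuous.comp
        (continuous_const.sub (continuous_unitary_inv_apply continuous_fst continuous_snd)))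
    have hsupp : HasCompactSupport fun p : unitary (E →L[ℝ] E) × E =>
        radialBump p.2 * h (x - (p.1⁻¹ : unitary (E →L[ℝ] E)).1 p.2) :=
      HasCompactSupport.intro (isCompact_univ.prod (isCompact_closedBall 0 1)) fun p hp => by
        have hp' : 1 ≤ ‖p.2‖ := by
          by_contra! hlt
          exact hp ⟨Set.mem_univ _, mem_closedBall_zero_iff.2 hlt.le⟩
        rw [radialBump_of_one_le hp', zero_mul]
    have h2 : c * I = m * (c * h x) := by
      calc c * I = ∫ k : unitary (E →L[ℝ] E), (∫ t, radialBump t *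
              h (x - (k⁻¹ : unitary (E →L[ℝ] E)).1 t)) ∂Measure.haar := by
            simp only [h1, integral_const, smul_eq_mul, hc, rotMass]
        _ = ∫ t, ∫ k : unitary (E →L[ℝ] E), radialBump t *
              h (x - (k⁻¹ : unitary (E →L[ℝ] E)).1 t) ∂Measure.haar :=
            integral_integral_swap (hcont.integrable_of_hasCompactSupport hsupp)
        _ = ∫ t : E, radialBump t * (c * h x) := by simp only [integral_const_mul, hmean]
        _ = m * (c * h x) := by rw [integral_mul_const]
    have h3 : I = m * h x := mul_left_cancel₀ hc0.ne' (by linarith)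
    rw [← h3]
    rfl
  have hconv : ContDiff ℝ ∞ (convolution (radialBump : E → ℝ) h
      (ContinuousLinearMap.lsmul ℝ ℝ) volume) :=
    hasCompactSupport_radialBump.contDiff_convolution_left _ contDiff_radialBump
      hh.continuous.locallyIntegrable
  have : h = fun x => m⁻¹ * convolution (radialBump : E → ℝ) h
      (ContinuousLinearMap.lsmul ℝ ℝ) volume x := by
    ext x
    rw [key, inv_mul_cancel_left₀ hm0.ne']
  rw [this]
  exact contDiff_const.mul hconv

end Regularity

/-! ### Sums of squares of harmonic functions -/

section SumSq

variable {E : Type*} [NormedAddCommGroup E] [InnerProductSpace ℝ E] {f : E → ℝ}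

theorem contDiff_fderiv_apply (hf : ContDiff ℝ ∞ f) (v : E) :
    ContDiff ℝ ∞ fun x => fderiv ℝ f x v :=
  (contDiff_infty_iff_fderiv.1 hf).2.clm_apply contDiff_const

theorem fderiv_fderiv_apply (hf : ContDiff ℝ ∞ f) (x v w : E) :
    fderiv ℝ (fun y => fderiv ℝ f y v) x w = fderiv ℝ (fderiv ℝ f) x w v := by
  have : DifferentiableAt ℝ (fderiv ℝ f) x :=
    (contDiff_infty_iff_fderiv.1 hf).2.differentiable (by simp) x
  rw [fderiv_clm_apply this (by fun_prop)]
  simp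

theorem fderiv_fderiv_apply_comm (hf : ContDiff ℝ ∞ f) (x v w : E) :
    fderiv ℝ (fun y => fderiv ℝ f y v) x w = fderiv ℝ (fun y => fderiv ℝ f y w) x v := by
  rw [fderiv_fderiv_apply hf, fderiv_fderiv_apply hf]
  exact second_derivative_symmetric (fun y => (hf.differentiable (by simp) y).hasFDerivAt)
    ((contDiff_infty_iff_fderiv.1 hf).2.differentiable (by simp) x).hasFDerivAt _ _

variable [FiniteDimensional ℝ E] {ι : Type*} [Fintype ι] (v : OrthonormalBasis ι ℝ E)

theorem laplacian_eq_sum_fderiv (hf : ContDiff ℝ ∞ f) (x : E) :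
    Laplacian.laplacian f x = ∑ j, fderiv ℝ (fun y => fderiv ℝ f y (v j)) x (v j) := by
  rw [InnerProductSpace.laplacian_eq_iteratedFDeriv_orthonormalBasis f v]
  exact Finset.sum_congr rfl fun j _ => by
    rw [iteratedFDeriv_two_apply, fderiv_fderiv_apply hf]; rfl

theorem laplacian_fderiv_apply_eq_zero (hf : ContDiff ℝ ∞ f)
    (hΔ : Laplacian.laplacian f = 0) (w : E) :
    Laplacian.laplacian (fun x => fderiv ℝ f x w) = 0 := by
  ext x
  have v := stdOrthonormalBasis ℝ E
  have hj : ∀ j, (fun y => fderiv ℝ (fun z => fderiv ℝ f z w) y (v j)) =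
      fun y => fderiv ℝ (fun z => fderiv ℝ f z (v j)) y w := fun j =>
    funext fun y => fderiv_fderiv_apply_comm hf y _ _
  rw [laplacian_eq_sum_fderiv v (contDiff_fderiv_apply hf w)]
  simp only [hj, fun j => fderiv_fderiv_apply_comm (contDiff_fderiv_apply hf (v j)) x w (v j)]
  have h1 : HasFDerivAt (fun y => ∑ j, fderiv ℝ (fun z => fderiv ℝ f z (v j)) y (v j))
      (∑ j, fderiv ℝ (fun y => fderiv ℝ (fun z => fderiv ℝ f z (v j)) y (v j)) x) x :=
    HasFDerivAt.fun_sum fun j _ => ((contDiff_fderiv_apply (contDiff_fderiv_apply hf (v j))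
      (v j)).differentiable (by simp) x).hasFDerivAt
  have h2 : (fun y => ∑ j, fderiv ℝ (fun z => fderiv ℝ f z (v j)) y (v j)) = fun _ => 0 := by
    funext y
    rw [← laplacian_eq_sum_fderiv v hf, hΔ]
    rfl
  rw [h2] at h1
  have h3 := congrArg (fun L => L w) (h1.unique (hasFDerivAt_const _ _))
  simpa [sum_apply] using h3

/-- Finite sums of squares of smooth harmonic functions. The class is stable under the Laplacian. -/
def IsHarmonicSumSq (u : E → ℝ) : Prop :=
  ∃ (κ : Type) (_ : Fintype κ) (f : κ → E → ℝ),
    (∀ i, ContDiff ℝ ∞ (f i) ∧ Laplacian.laplacian (f i) = 0) ∧ u = fun x => ∑ i, f i x ^ 2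

theorem IsHarmonicSumSq.contDiff {u : E → ℝ} (hu : IsHarmonicSumSq u) : ContDiff ℝ ∞ u := by
  obtain ⟨κ, _, f, hf, rfl⟩ := hu
  exact ContDiff.sum fun i _ => (hf i).1.pow 2

theorem IsHarmonicSumSq.nonneg {u : E → ℝ} (hu : IsHarmonicSumSq u) (x : E) : 0 ≤ u x := by
  obtain ⟨κ, _, f, hf, rfl⟩ := hu
  exact Finset.sum_nonneg fun i _ => sq_nonneg _

theorem IsHarmonicSumSq.laplacian {u : E → ℝ} (hu : IsHarmonicSumSq u) :
    IsHarmonicSumSq (Laplacian.laplacian u) := by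
  have hsm := hu.contDiff
  obtain ⟨κ, _, f, hf, rfl⟩ := hu
  have v := stdOrthonormalBasis ℝ E
  refine ⟨κ × Fin (Module.finrank ℝ E), inferInstance,
    fun p x => √2 * fderiv ℝ (f p.1) x (v p.2), fun p => ⟨contDiff_const.mul
      (contDiff_fderiv_apply (hf p.1).1 _), ?_⟩, ?_⟩
  · ext x
    have h2 := InnerProductSpace.laplacian_smul (√2)
      ((contDiff_infty.1 (contDiff_fderiv_apply (hf p.1).1 (v p.2)) 2).contDiffAt (x := x))
    rw [laplacian_fderiv_apply_eq_zero (hf p.1).1 (hf p.1).2] at h2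
    rw [Pi.zero_apply, smul_zero] at h2
    exact h2
  · ext x
    have hd : ∀ i y, HasFDerivAt (f i) (fderiv ℝ (f i) y) y := fun i y =>
      ((hf i).1.differentiable (by simp) y).hasFDerivAt
    have h1 : ∀ y w, fderiv ℝ (fun x => ∑ i, f i x ^ 2) y w =
        ∑ i, 2 * (f i y * fderiv ℝ (f i) y w) := by
      intro y w
      have : HasFDerivAt (fun x => ∑ i, f i x ^ 2)
          (∑ i, (2 * f i y) • fderiv ℝ (f i) y) y :=
        HasFDerivAt.fun_sum fun i _ => by simpa using (hd i y).pow 2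
      rw [this.fderiv, sum_apply]
      exact Finset.sum_congr rfl fun i _ => by simp [mul_assoc]
    have h2 : ∀ w, fderiv ℝ (fun y => ∑ i, 2 * (f i y * fderiv ℝ (f i) y w)) x w =
        ∑ i, 2 * (f i x * fderiv ℝ (fun y => fderiv ℝ (f i) y w) x w +
          fderiv ℝ (f i) x w * fderiv ℝ (f i) x w) := by
      intro w
      have : HasFDerivAt (fun y => ∑ i, 2 * (f i y * fderiv ℝ (f i) y w))
          (∑ i, (2 : ℝ) • (f i x • fderiv ℝ (fun y => fderiv ℝ (f i) y w) x +
            fderiv ℝ (f i) x w • fderiv ℝ (f i) x)) x :=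
        HasFDerivAt.fun_sum fun i _ => ((hd i x).mul
          ((contDiff_fderiv_apply (hf i).1 w).differentiable (by simp) x).hasFDerivAt).const_mul 2
      rw [this.fderiv, sum_apply]
      simp [mul_add]
    rw [laplacian_eq_sum_fderiv v hsm]
    simp only [h1, h2]
    rw [Finset.sum_comm, Fintype.sum_prod_type]
    refine Finset.sum_congr rfl fun i _ => ?_
    rw [← Finset.mul_sum, Finset.sum_add_distrib, ← Finset.mul_sum,
      ← laplacian_eq_sum_fderiv v (hf i).1, (hf i).2, Pi.zero_apply, mul_zero, zero_add,
      Finset.mul_sum]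
    refine Finset.sum_congr rfl fun j _ => ?_
    rw [mul_pow, Real.sq_sqrt zero_le_two]
    ring

end SumSq

/-! ### Spherical means of a harmonic map -/

section HarmonicMap

open MeasureTheory

variable {s m : ℕ} {h : EuclideanSpace ℝ (Fin (s + 1)) → EuclideanSpace ℝ (Fin m)}

theorem isHarmonicSumSq_norm_sq (hs : 1 ≤ s) (hh : InnerProductSpace.HarmonicOnNhd h Set.univ) :
    IsHarmonicSumSq fun y => ‖h y‖ ^ 2 := by
  refine ⟨Fin m, inferInstance, fun i y => h y i, fun i => ?_, ?_⟩
  · have h1 := hh.comp_CLM (EuclideanSpace.proj i : EuclideanSpace ℝ (Fin m) →L[ℝ] ℝ)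
    have h2 : ContDiff ℝ 2 fun y => h y i := contDiff_iff_contDiffAt.2 fun y => (h1 y trivial).1
    have h3 : Laplacian.laplacian (fun y => h y i) = 0 :=
      funext fun y => (h1 y trivial).2.self_of_nhds
    exact ⟨contDiff_of_harmonic hs (EuclideanSpace.basisFun _ ℝ) h2 h3, h3⟩
  · ext y
    rw [EuclideanSpace.norm_sq_eq]
    simp

theorem hasSum_rotAvg {u : EuclideanSpace ℝ (Fin (s + 1)) → ℝ} (hs : 1 ≤ s)
    (hu : IsHarmonicSumSq u) :
    ∃ a : ℕ → ℝ, (∀ k, 0 ≤ a k) ∧ a 0 = rotAvg u 0 ∧ ∀ r : ℝ, 0 < r →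
      HasSum (fun k => a k * r ^ (2 * k)) (rotAvg u (r • EuclideanSpace.basisFun _ ℝ 0)) := by
  set e : EuclideanSpace ℝ (Fin (s + 1)) := EuclideanSpace.basisFun _ ℝ 0 with he
  set U : ℕ → EuclideanSpace ℝ (Fin (s + 1)) → ℝ := fun k => Laplacian.laplacian^[k] u with hU
  have hU1 : ∀ k, U (k + 1) = Laplacian.laplacian (U k) := fun k =>
    Function.iterate_succ_apply' _ _ _
  have hUs : ∀ k, IsHarmonicSumSq (U k) := by
    intro k
    induction k with
    | zero => exact hu
    | succ k ih => rw [hU1]; exact ih.laplacian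
  have hU2 : ∀ k, ContDiff ℝ 2 (U k) := fun k => contDiff_infty.1 (hUs k).contDiff 2
  have hnn : ∀ k y, 0 ≤ rotAvg (U k) y := fun k y => integral_nonneg fun _ => (hUs k).nonneg _
  refine ⟨fun k => pizzettiCoeff s k * rotAvg (U k) ((0 : ℝ) • e),
    fun k => mul_nonneg (pizzettiCoeff_nonneg s k) (hnn k _), ?_, fun r hr => ?_⟩
  · simp [pizzettiCoeff, hU]
  · refine hasSum_of_scaleAvg (s := s) (g := fun k r => rotAvg (U k) (r • e))
      (fun k => (continuous_rotAvg (hU2 k).continuous).comp (by fun_prop))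
      (fun k r _ => hnn k _) (fun k => ?_) (fun k r hr => ?_) hr
    · exact monotoneOn_rotAvg (hU2 k) (fun y => by rw [← hU1]; exact (hUs _).nonneg y) hs _
    · simp only [hU1]
      exact rotAvg_eq_add_scaleAvg (hU2 k) hs _ hr

end HarmonicMap

/-! ### Log-tropical weights from power series -/

theorem continuous_of_isTropicalPowerSeries {Ψ : ℝ → ℝ} (h : IsTropicalPowerSeries Ψ) :
    Continuous Ψ := by
  obtain ⟨E, b, h⟩ := h
  have hconv : ConvexOn ℝ Set.univ Ψ := by
    refine ⟨convex_univ, fun x _ y _ α β hα hβ hαβ => (h _).2 ?_⟩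
    rintro _ ⟨j, hj, rfl⟩
    have h1 := mul_le_mul_of_nonneg_left (line_le h hj x) hα
    have h2 := mul_le_mul_of_nonneg_left (line_le h hj y) hβ
    simp only [smul_eq_mul]
    have : b j = (α + β) * b j := by rw [hαβ, one_mul]
    linarith
  exact continuousOn_univ.1 (hconv.continuousOn isOpen_univ)

theorem monotone_of_isTropicalPowerSeries {Ψ : ℝ → ℝ} (h : IsTropicalPowerSeries Ψ) :
    Monotone Ψ := by
  obtain ⟨E, b, h⟩ := h
  intro x y hxy
  refine (h x).2 ?_
  rintro _ ⟨j, hj, rfl⟩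
  refine le_trans ?_ (line_le h hj y)
  simp only
  gcongr

/-- If `w²` is comparable to a power series in `t²` with non-negative coefficients, then `w` is
equivalent to a log-tropical weight. The weight is `t ↦ exp (Ψ (log t))` for the tropical minorant
`Ψ`, extended to `0` by continuity. -/
theorem equivLogTropical_of_hasSum {w : ℝ≥0 → ℝ} (hw : IsWeightFunction w) {a : ℕ → ℝ}
    {M : ℝ → ℝ} (ha : ∀ k, 0 ≤ a k) (hM0 : a 0 = M 0) (hMc : Continuous M)
    (hM : ∀ r, 0 < r → HasSum (fun k => a k * r ^ (2 * k)) (M r))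
    {A B : ℝ} (hA : 0 < A) (hB : 0 < B)
    (hMw : ∀ t : ℝ≥0, A * w t ^ 2 ≤ M t ∧ M t ≤ B * w t ^ 2) : EquivLogTropical w := by
  have hMpos : ∀ t : ℝ≥0, 0 < M t := fun t =>
    (mul_pos hA (pow_pos (hw.pos t) 2)).trans_le (hMw t).1
  have ha0 : 0 < a 0 := by rw [hM0]; exact_mod_cast hMpos 0
  obtain ⟨E, b, Ψ, -, hlub, h1, h2, h3⟩ := exists_tropical_of_hasSum ha hM
    (fun r hr => hMpos ⟨r, hr.le⟩)
  have hΨ : IsTropicalPowerSeries Ψ := ⟨E, b, hlub⟩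
  set v : ℝ≥0 → ℝ := fun t => if t = 0 then √(a 0) else Real.exp (Ψ (Real.log t)) with hv
  have hv0 : v 0 = √(a 0) := if_pos rfl
  have hvt : ∀ {t : ℝ≥0}, t ≠ 0 → v t = Real.exp (Ψ (Real.log t)) := fun ht => if_neg ht
  have hexp : ∀ {t : ℝ≥0}, t ≠ 0 → Real.exp (Real.log t) = t := fun {t} ht =>
    Real.exp_log (by positivity)
  have hvpos : ∀ t, 0 < v t := by
    intro t
    by_cases ht : t = 0
    · rw [ht, hv0]; positivity
    · rw [hvt ht]; positivity
  have hvM : ∀ t, v t ^ 2 ≤ M t ∧ M t ≤ 2 * v t ^ 2 := by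
    intro t
    by_cases ht : t = 0
    · rw [ht, hv0, Real.sq_sqrt ha0.le, NNReal.coe_zero, ← hM0]
      constructor <;> linarith
    · have := h1 (Real.log t)
      have := h2 (Real.log t)
      rw [hexp ht] at *
      rw [hvt ht]
      constructor <;> assumption
  have hv0le : ∀ t, √(a 0) ≤ v t := by
    intro t
    by_cases ht : t = 0
    · rw [ht, hv0]
    · rw [hvt ht]
      exact Real.sqrt_le_iff.2 ⟨by positivity, h3 _⟩
  have hcont : Continuous v := by
    refine continuous_iff_continuousAt.2 fun t => ?_
    by_cases ht : t = 0
    -- at the origin, `v` is squeezed between `√(a 0)` and `√(M t)`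
    · subst ht
      have hlim : Filter.Tendsto (fun t : ℝ≥0 => √(M t)) (nhds 0) (nhds √(a 0)) := by
        have : Continuous fun t : ℝ≥0 => √(M t) := by fun_prop
        have h := this.tendsto 0
        rwa [NNReal.coe_zero, ← hM0] at h
      have : Filter.Tendsto v (nhds 0) (nhds √(a 0)) :=
        tendsto_of_tendsto_of_tendsto_of_le_of_le tendsto_const_nhds hlim hv0le
          fun t => Real.le_sqrt_of_sq_le (hvM t).1
      rwa [← hv0] at this
    · have hev : (fun t : ℝ≥0 => Real.exp (Ψ (Real.log t))) =ᶠ[nhds t] v := by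
        filter_upwards [isOpen_ne.mem_nhds ht] with y hy
        exact (hvt hy).symm
      refine ContinuousAt.congr ?_ hev
      have h4 : ContinuousAt (fun t : ℝ≥0 => Real.log t) t :=
        (Real.continuousAt_log (NNReal.coe_ne_zero.2 ht)).comp
          NNReal.continuous_coe.continuousAt
      exact (Real.continuous_exp.comp
        (continuous_of_isTropicalPowerSeries hΨ)).continuousAt.comp h4
  have hmono : Monotone v := by
    intro x y hxy
    by_cases hx : x = 0
    · rw [hx, hv0]; exact hv0le y
    · have hx' : 0 < x := pos_iff_ne_zero.2 hx
      have hy : y ≠ 0 := (hx'.trans_le hxy).ne'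
      rw [hvt hx, hvt hy]
      exact Real.exp_le_exp.2 (monotone_of_isTropicalPowerSeries hΨ
        (Real.log_le_log (by exact_mod_cast hx') (by exact_mod_cast hxy)))
  have hvw : ∀ t, (√B)⁻¹ * v t ≤ w t ∧ w t ≤ √(2 / A) * v t := by
    intro t
    have hwt := hw.pos t
    constructor
    · rw [inv_mul_le_iff₀ (by positivity)]
      refine le_of_sq_le_sq ?_ (by positivity)
      rw [mul_pow, Real.sq_sqrt hB.le]
      exact (hvM t).1.trans (hMw t).2
    · refine le_of_sq_le_sq ?_ (mul_nonneg (by positivity) (hvpos t).le)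
      rw [mul_pow, Real.sq_sqrt (by positivity), div_mul_eq_mul_div, le_div_iff₀ hA]
      linarith [(hMw t).1, (hvM t).2]
  refine ⟨v, ⟨⟨hvpos, hmono, hcont, ?_⟩, ?_⟩, (√B)⁻¹, √(2 / A), by positivity, by positivity, hvw⟩
  · rintro ⟨C, hC⟩
    refine hw.unbounded ⟨√(2 / A) * C, ?_⟩
    rintro _ ⟨t, rfl⟩
    exact (hvw t).2.trans (mul_le_mul_of_nonneg_left (hC ⟨t, rfl⟩) (by positivity))
  · convert hΨ using 1
    ext x
    have hx : (Real.exp x).toNNReal ≠ 0 := by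
      rw [ne_eq, Real.toNNReal_eq_zero, not_le]; positivity
    rw [logTransform, hvt hx, Real.coe_toNNReal _ (Real.exp_pos x).le, Real.log_exp, Real.log_exp]

theorem equivLogTropical_of_harmonicApproximable {s : ℕ} (hs : 1 ≤ s) {w : ℝ≥0 → ℝ}
    (hw : IsWeightFunction w) (h : HarmonicApproximable (s + 1) w) : EquivLogTropical w := by
  obtain ⟨m, h, -, hh, C₁, C₂, hC₁, hC₂, hhw⟩ := h
  obtain ⟨a, ha, ha0, hsum⟩ := hasSum_rotAvg hs (isHarmonicSumSq_norm_sq hs hh)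
  set e : EuclideanSpace ℝ (Fin (s + 1)) := EuclideanSpace.basisFun _ ℝ 0 with he
  have he1 : ‖e‖ = 1 := (EuclideanSpace.basisFun (Fin (s + 1)) ℝ).orthonormal.1 0
  set u : EuclideanSpace ℝ (Fin (s + 1)) → ℝ := fun y => ‖h y‖ ^ 2 with hu
  have huc : Continuous u := (isHarmonicSumSq_norm_sq hs hh).contDiff.continuous
  set c := rotMass (EuclideanSpace ℝ (Fin (s + 1))) with hc
  have hc0 : 0 < c := rotMass_pos _
  have hnorm : ∀ (t : ℝ≥0) (z : EuclideanSpace ℝ (Fin (s + 1))), ‖z‖ = ‖(t : ℝ) • e‖ → ‖z‖₊ = t :=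
      fun t z hz => by
    refine NNReal.eq ?_
    rw [coe_nnnorm, hz, norm_smul, he1, mul_one, NNReal.norm_eq]
  refine equivLogTropical_of_hasSum hw (M := fun r => rotAvg u (r • e)) ha
    (by simpa using ha0) ((continuous_rotAvg huc).comp (by fun_prop)) hsum
    (A := c * (C₂ ^ 2)⁻¹) (B := c * (C₁ ^ 2)⁻¹) (by positivity) (by positivity) fun t => ?_
  have hw0 := (hw.pos t).le
  constructor
  · rw [mul_assoc]
    refine rotMass_mul_le_rotAvg huc fun z hz => ?_
    have h1 := (hhw z).2
    rw [radialWeight, hnorm t z hz] at h1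
    simp only [hu]
    rw [inv_mul_le_iff₀ (by positivity), ← mul_pow]
    gcongr
  · rw [mul_assoc]
    refine rotAvg_le_rotMass_mul huc fun z hz => ?_
    have h1 := (hhw z).1
    rw [radialWeight, hnorm t z hz] at h1
    simp only [hu]
    rw [le_inv_mul_iff₀ (by positivity), ← mul_pow]
    gcongr

theorem proposition5p3 (q : ℕ) (hq : 2 ≤ q) (w : ℝ≥0 → ℝ) (hw : IsWeightFunction w) :
    (HarmonicApproximable q w → EquivLogTropical w) ∧
      (Even q → (HarmonicApproximable q w ↔ EquivLogTropical w)) := by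
  have hi : HarmonicApproximable q w → EquivLogTropical w := by
    obtain ⟨s, rfl⟩ := Nat.exists_eq_add_of_le' (show 1 ≤ q by omega)
    exact equivLogTropical_of_harmonicApproximable (by omega) hw
  refine ⟨hi, fun hev => ⟨hi, fun h => ?_⟩⟩
  obtain ⟨p, rfl⟩ := hev
  exact harmonicApproximable_of_equivLogTropical (by omega) h
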